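/- The Homflypt polynomial $P_L(v,z)\in\mathbb{Z}[v^{\pm1},z^{\pm1}]$ of oriented links $L$ is the unique link invariant which equals $1$ on the trivial knot and satisfies $P_{D_+}=vz\,P_{D_0}+v^2P_{D_-}$ for diagrams $D_+,D_0,D_-$ that agree except at one crossing, which is positive, smoothed, and negative, respectively (existence and uniqueness are part of the statement; oriented links are presented as closures of braids up to Markov moves). Write $\nabla_L(z)=P_L(1,z)$ for the Conway polynomial, and, for $p\in\mathbb{Z}$, let $C_p=C_p(z)$ be the Conway polynomial of the closure of the 2-braid $\sigma_1^p$. **Theorem.** Let $n\ge 1$, let $\beta\in B_n$ be a braid with writhe (exponent sum) $w$, and let $\widehat\beta$ be its closure. There are unique polynomials $p_0,\dots,p_{n-1}\in\mathbb{Z}[z]$ with $$P_{\widehat\beta}(v,z)=\frac{v^w\sum_{j=0}^{n-1}p_j(z)\,v^{2j}}{(vz)^{n-1}} .$$ Put $p_j=0$ for $j\ge n$. Then, in $\mathbb{Z}[z,z^{-1}]$ (empty sums being $0$), 1. $p_0=z^{n-3}\{C_{w+4-n}-\nabla_{\widehat\beta}\}-q_0$, with $q_0=\sum_{j=3}^{n-1}z^{-2}(C_{2j-3}-1)\,p_j$;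 2. $p_1=z^{n-1}\nabla_{\widehat\beta}-p_0-p_2-\sum_{j=3}^{n-1}p_j$; 3. $p_2=z^{n-3}\{C_{w+2-n}-\nabla_{\widehat\beta}\}-q_2$, with $q_2=\sum_{j=3}^{n-1}z^{-2}(C_{2j-1}-1)\,p_j$. Moreover, $$\frac{C_{2j-3}-1}{z^2}=\sum_{i=0}^{j-3}\binom{2j-4-i}{i}z^{2j-6-2i}\quad(j\ge 3),\qquad \frac{C_{2j-1}-1}{z^2}=\sum_{i=0}^{j-2}\binom{2j-2-i}{i}z^{2j-4-2i}\quad(j\ge 1).$$ -/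

import Mathlib

open scoped LaurentPolynomial

/-- Defining relations of the braid group on `n` strands, on the generators `σ_1, …, σ_{n-1}`
(indexed by `0, …, n - 2`). -/
inductive BraidRel (n : ℕ) : FreeGroup (Fin (n - 1)) → Prop
  | comm (i j : Fin (n - 1)) (h : (i : ℕ) + 2 ≤ j) :
      BraidRel n (FreeGroup.of i * FreeGroup.of j *
        (FreeGroup.of i)⁻¹ * (FreeGroup.of j)⁻¹)
  | braid (i j : Fin (n - 1)) (h : (i : ℕ) + 1 = j) :
      BraidRel n (FreeGroup.of i * FreeGroup.of j * FreeGroup.of i *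
        (FreeGroup.of j * FreeGroup.of i * FreeGroup.of j)⁻¹)

/-- The braid group `B_n` on `n` strands (Artin's presentation). -/
abbrev BraidGroup (n : ℕ) : Type := PresentedGroup {r | BraidRel n r}

namespace BraidGroup

/-- The standard (positive) generators; `σ i` is usually written `σ_{i+1}`. -/
def σ {n : ℕ} (i : Fin (n - 1)) : BraidGroup n := PresentedGroup.of i

theorem comm_rel {n : ℕ} {i j : Fin (n - 1)} (h : (i : ℕ) + 2 ≤ j) :
    (σ i : BraidGroup n) * σ j = σ j * σ i := by
  have := PresentedGroup.one_of_mem (rels := {r | BraidRel n r}) (BraidRel.comm i j h)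
  simp only [map_mul, map_inv] at this
  exact commutatorElement_eq_one_iff_mul_comm.mp this

theorem braid_rel {n : ℕ} {i j : Fin (n - 1)} (h : (i : ℕ) + 1 = j) :
    (σ i : BraidGroup n) * σ j * σ i = σ j * σ i * σ j := by
  have := PresentedGroup.one_of_mem (rels := {r | BraidRel n r}) (BraidRel.braid i j h)
  simp only [map_mul, map_inv] at this
  exact mul_inv_eq_one.mp this

/-- The exponent sum as a homomorphism `B_n → ℤ`. -/
def writheHom (n : ℕ) : BraidGroup n →* Multiplicative ℤ :=
  PresentedGroup.toGroup (f := fun _ => Multiplicative.ofAdd 1) (by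
    rintro r (⟨i, j, h⟩ | ⟨i, j, h⟩)
    · simp
    · simp)

/-- The writhe (exponent sum) `w(β) = ∑ ε_k` of a braid `β = ∏ σ_{i_k}^{ε_k}`. -/
def writhe {n : ℕ} (β : BraidGroup n) : ℤ := Multiplicative.toAdd (writheHom n β)

/-- The inclusion `B_n → B_{n+1}`, `σ_i ↦ σ_i`, adding a trivial last strand. -/
def incl (n : ℕ) : BraidGroup n →* BraidGroup (n + 1) :=
  PresentedGroup.toGroup
    (f := fun i : Fin (n - 1) => (σ (⟨i, by omega⟩ : Fin (n + 1 - 1)) : BraidGroup (n + 1))) (by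
    rintro r (⟨i, j, h⟩ | ⟨i, j, h⟩)
    · simp only [map_mul, map_inv, FreeGroup.lift_apply_of]
      exact commutatorElement_eq_one_iff_mul_comm.mpr (comm_rel h)
    · simp only [map_mul, map_inv, FreeGroup.lift_apply_of]
      exact mul_inv_eq_one.mpr (braid_rel h))

/-- The last generator `σ_n` of `B_{n+1}`, for `n ≥ 1`. -/
def last (n : ℕ) (hn : 1 ≤ n) : BraidGroup (n + 1) :=
  σ (⟨n - 1, by omega⟩ : Fin (n + 1 - 1))

end BraidGroup

/-- A closed braid diagram: a braid on a positive number of strands, to be closed up in the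
standard way. -/
structure ClosedBraid where
  strands : ℕ
  pos : 1 ≤ strands
  braid : BraidGroup strands

/-- The Markov moves: conjugation and positive or negative stabilization. -/
inductive MarkovMove : ClosedBraid → ClosedBraid → Prop
  | conj {n : ℕ} (hn : 1 ≤ n) (α β : BraidGroup n) :
      MarkovMove ⟨n, hn, α * β⟩ ⟨n, hn, β * α⟩
  | stab_pos {n : ℕ} (hn : 1 ≤ n) (β : BraidGroup n) :
      MarkovMove ⟨n, hn, β⟩ ⟨n + 1, Nat.le_add_left 1 n, BraidGroup.incl n β * BraidGroup.last n hn⟩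
  | stab_neg {n : ℕ} (hn : 1 ≤ n) (β : BraidGroup n) :
      MarkovMove ⟨n, hn, β⟩
        ⟨n + 1, Nat.le_add_left 1 n, BraidGroup.incl n β * (BraidGroup.last n hn)⁻¹⟩

/-- Isotopy classes of (nonempty) oriented links in 3-space, presented as closed braids up to the
equivalence relation generated by the Markov moves (theorems of Alexander and Markov). -/
def OrientedLink : Type := Quot MarkovMove

/-- The oriented link `β̂` obtained as the standard closure of a braid `β ∈ B_n`, `n ≥ 1`. -/
def BraidGroup.closure {n : ℕ} (hn : 1 ≤ n) (β : BraidGroup n) : OrientedLink :=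
  Quot.mk MarkovMove ⟨n, hn, β⟩

/-- The ring `ℤ[v, v⁻¹, z, z⁻¹]`: Laurent polynomials in `v` over Laurent polynomials in `z`. -/
abbrev LaurentVZ : Type := ℤ[T;T⁻¹][T;T⁻¹]

namespace LaurentVZ

/-- The variable `v`. -/
noncomputable def v : LaurentVZ := LaurentPolynomial.T 1

/-- The variable `z`. -/
noncomputable def z : LaurentVZ := LaurentPolynomial.C (LaurentPolynomial.T 1)

/-- The substitution `f(v, z) ↦ f(1, z)`. -/
noncomputable def atVOne : LaurentVZ →+* ℤ[T;T⁻¹] :=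
  LaurentPolynomial.eval₂ (RingHom.id _) 1

end LaurentVZ

open LaurentVZ in
/-- The defining properties of the Homflypt polynomial as an invariant of oriented links: it is
`1` on the trivial knot, and `P(D₊) = v z P(D₀) + v² P(D₋)` at every crossing of every closed
braid diagram (the three diagrams having `σ_i`, no crossing, `σ_i⁻¹` in that place). -/
structure IsHomflypt (P : OrientedLink → LaurentVZ) : Prop where
  unknot : P (BraidGroup.closure (n := 1) le_rfl 1) = 1
  skein : ∀ {n : ℕ} (hn : 1 ≤ n) (α β : BraidGroup n) (i : Fin (n - 1)),
    P (BraidGroup.closure hn (α * BraidGroup.σ i * β)) =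
      v * z * P (BraidGroup.closure hn (α * β)) +
        v ^ 2 * P (BraidGroup.closure hn (α * (BraidGroup.σ i)⁻¹ * β))

/-- The Homflypt polynomial `P_L(v, z)` of an oriented link: the function with the properties
`IsHomflypt`. (That there is exactly one is asserted in the theorem.) -/
noncomputable def homflypt : OrientedLink → LaurentVZ := Classical.epsilon IsHomflypt

/-- The Conway polynomial `∇_L(z) = P_L(1, z)`. -/
noncomputable def conway (L : OrientedLink) : ℤ[T;T⁻¹] := LaurentVZ.atVOne (homflypt L)

/-- `C_p(z)`, the Conway polynomial of the elementary torus link `T_p`, the closure of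
`σ_1 ^ p ∈ B_2`, for `p ∈ ℤ`. -/
noncomputable def torusConway (p : ℤ) : ℤ[T;T⁻¹] :=
  conway (BraidGroup.closure (n := 2) one_le_two ((BraidGroup.σ (0 : Fin 1)) ^ p))

open LaurentVZ in
/-- `p_0, p_1, …` are the coefficient polynomials of `P_{β̂}`, in the form
`P_{β̂}(v, z) = v^w (∑_{j=0}^{n-1} p_j(z) v^{2j}) / (vz)^{n-1}` with `p_j ∈ ℤ[z]`,
where `w` is the writhe of `β`; by convention `p_j = 0` for `j ≥ n`. -/
structure IsCoeffs {n : ℕ} (hn : 1 ≤ n) (β : BraidGroup n) (p : ℕ → Polynomial ℤ) : Prop where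
  eq_zero : ∀ j, n ≤ j → p j = 0
  form : homflypt (BraidGroup.closure hn β) * (v * z) ^ (n - 1) =
    LaurentPolynomial.T (BraidGroup.writhe β) *
      ∑ j ∈ Finset.range n, LaurentPolynomial.C (Polynomial.toLaurent (p j)) * v ^ (2 * j)

/-!
Write `P(v, z) = v ^ w X(z, v²) / (vz) ^ (n - 1)` for the closure of a braid on `n` strands of
writhe `w`. The defining properties of the Homflypt polynomial `P` say exactly that `X`, as a
function of closed braids, is Ocneanu's trace: it factors through the Hecke relation
`T_i = z + T_i⁻¹`, is invariant under conjugation, is multiplied by `1 - y` (where `y = v²`) when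
a free strand is added and by `z` under a positive stabilization. Such functions are formalised,
with values in any abelian group, by `IsMarkovTrace`.

Uniqueness and the form of `P` both come from the identity `H_{n+1} = H_n + H_n T_n H_n` for Hecke
algebras, in the guise of `IsSkein.mem_of_mem`. Its consequence `IsMarkovTrace.mem` confines the
values of a Markov trace to any family of subgroups stable under the two operators; for the zero
subgroups this is uniqueness (`IsMarkovTrace.ext`), and for the polynomials in `y` of degree less
than `n` over `ℤ[z]` it is the asserted form of `P`.

Existence does not use a basis of the Hecke algebra. The R-matrices of type `A_{N-1}` give
real-valued Markov traces with `z = q - q⁻¹` and `y = q ^ (-2N)` (`isMarkovTrace_normTrace`). By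
`IsMarkovTrace.mem`, applied to the functions of `(q, N)`, all these values at a given closed braid
are those of one polynomial in `ℤ[z][y]`. The polynomial is unique, since there are enough pairs
`(q, N)`, and thus inherits the properties of a Markov trace (`exists_isMarkovTrace`).

The formulas for `p_0, p_1, p_2` are three linear equations. One is the definition of `∇` at
`v = 1`. The other two express that `P(v, v⁻¹ - v) = 1` for every link: with `u = v⁻¹`, a root of
`u² = z u + 1`, one has `u ^ k = C_k u + C_{k-1}`, and comparing coefficients yields
`∑ p_j C_{k-2j} = z ^ (n-1) C_{k+w-n+1}` for all `k` (`IsCoeffs.sum_mul_torusConway`). This is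
proved as an identity of two Markov traces, and used for `k = 1` and `k = 3`. The sums of binomial
coefficients arise because the `C_k` are the Fibonacci polynomials.
-/

/-! ### Braid groups -/

namespace BraidGroup

theorem incl_σ {n : ℕ} (i : Fin (n - 1)) :
    incl n (σ i) = σ (⟨i, by omega⟩ : Fin (n + 1 - 1)) := by
  simp [incl, σ]

theorem σ_eq_incl_or_last {n : ℕ} (hn : 1 ≤ n) (i : Fin (n + 1 - 1)) :
    (∃ j : Fin (n - 1), (σ i : BraidGroup (n + 1)) = incl n (σ j)) ∨ σ i = last n hn := by
  by_cases h : (i : ℕ) < n - 1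
  · exact Or.inl ⟨⟨i, h⟩, (incl_σ (n := n) ⟨i, h⟩).symm⟩
  · right
    rw [last]
    congr 1
    ext
    have := i.2
    simp only
    omega

theorem last_mul_incl_incl {n : ℕ} (hn : 1 ≤ n) (β : BraidGroup n) :
    last (n + 1) (by omega) * incl (n + 1) (incl n β) =
      incl (n + 1) (incl n β) * last (n + 1) (by omega) := by
  have h : β ∈ Subgroup.closure (Set.range (PresentedGroup.of (rels := {r | BraidRel n r}))) := by
    rw [PresentedGroup.closure_range_of]; trivial
  change Commute _ _
  induction h using Subgroup.closure_induction with
  | mem x hx =>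
    obtain ⟨i, rfl⟩ := hx
    change Commute _ (incl (n + 1) (incl n (σ i)))
    rw [incl_σ, incl_σ]
    refine (comm_rel ?_).symm
    have := i.2
    simp only
    omega
  | one => simp
  | mul x y _ _ hx hy => simpa using hx.mul_right hy
  | inv x _ hx => simpa using hx.inv_right

theorem last_incl_last_last {n : ℕ} (hn : 1 ≤ n) :
    last (n + 1) (by omega) * incl (n + 1) (last n hn) * last (n + 1) (by omega) =
      incl (n + 1) (last n hn) * last (n + 1) (by omega) * incl (n + 1) (last n hn) := by
  rw [last, last, incl_σ]
  refine (braid_rel ?_).symm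
  simp only
  omega

@[elab_as_elim]
theorem induction_right {n : ℕ} {p : BraidGroup n → Prop} (β : BraidGroup n) (one : p 1)
    (mul : ∀ β i, p β → p (β * σ i)) (mul_inv : ∀ β i, p β → p (β * (σ i)⁻¹)) : p β := by
  have h : β ∈ Subgroup.closure (Set.range (PresentedGroup.of (rels := {r | BraidRel n r}))) := by
    rw [PresentedGroup.closure_range_of]; trivial
  induction h using Subgroup.closure_induction_right with
  | one => exact one
  | mul_right x _ y hy ih => obtain ⟨i, rfl⟩ := hy; exact mul x i ih
  | mul_inv_cancel x _ y hy ih => obtain ⟨i, rfl⟩ := hy; exact mul_inv x i ih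

instance : Subsingleton (BraidGroup 1) := by
  refine ⟨fun a b => ?_⟩
  have h : ∀ a : BraidGroup 1, a = 1 := fun a => by
    induction a using induction_right with
    | one => rfl
    | mul _ i => exact i.elim0
    | mul_inv _ i => exact i.elim0
  rw [h a, h b]

@[simp] theorem writhe_one {n : ℕ} : writhe (1 : BraidGroup n) = 0 := by simp [writhe]

@[simp] theorem writhe_mul {n : ℕ} (α β : BraidGroup n) :
    writhe (α * β) = writhe α + writhe β := by simp [writhe]

@[simp] theorem writhe_inv {n : ℕ} (α : BraidGroup n) : writhe α⁻¹ = -writhe α := by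
  simp [writhe]

@[simp] theorem writhe_σ {n : ℕ} (i : Fin (n - 1)) : writhe (σ i : BraidGroup n) = 1 := by
  simp [writhe, writheHom, σ]

@[simp] theorem writhe_last {n : ℕ} (hn : 1 ≤ n) : writhe (last n hn) = 1 := writhe_σ _

@[simp] theorem writhe_incl {n : ℕ} (β : BraidGroup n) : writhe (incl n β) = writhe β := by
  induction β using induction_right with
  | one => simp
  | mul β i ih => simp [ih, incl_σ]
  | mul_inv β i ih => simp [ih, incl_σ]

end BraidGroup

open BraidGroup

/-! ### Skein functions and Markov traces -/

section MarkovTrace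

variable {M : Type*} [AddCommGroup M]

/-- `G` satisfies the skein relation of the normalised generators `T_i = v⁻¹ σ_i`, that is
`T_i = z + T_i⁻¹`; the coefficient `z` acts on the values as an additive endomorphism. -/
def IsSkein (z : M →+ M) {n : ℕ} (G : BraidGroup n → M) : Prop :=
  ∀ α β i, G (α * σ i * β) = z (G (α * β)) + G (α * (σ i)⁻¹ * β)

namespace IsSkein

variable {z : M →+ M} {n : ℕ}

theorem mul_right {G : BraidGroup n → M} (hG : IsSkein z G) (γ : BraidGroup n) :
    IsSkein z fun β => G (β * γ) := fun α β i => by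
  simpa only [mul_assoc] using hG α (β * γ) i

theorem apply_mul_inv {G : BraidGroup n → M} (hG : IsSkein z G) (α β : BraidGroup n)
    (i : Fin (n - 1)) : G (α * (σ i)⁻¹ * β) = G (α * σ i * β) - z (G (α * β)) := by
  rw [hG]; abel

theorem incl {G : BraidGroup (n + 1) → M} (hG : IsSkein z G) (γ δ : BraidGroup (n + 1)) :
    IsSkein z fun β => G (γ * BraidGroup.incl n β * δ) := fun α β i => by
  simpa only [map_mul, map_inv, incl_σ, mul_assoc] using
    hG (γ * BraidGroup.incl n α) (BraidGroup.incl n β * δ) ⟨i, by omega⟩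

/-- The inductive step of `mem_of_mem`: all that remains is to absorb a final `σ_n`. -/
theorem mem_of_mem_of_last (S : AddSubgroup M) (hS : ∀ x ∈ S, z x ∈ S) (hn : 1 ≤ n)
    (key : ∀ G : BraidGroup (n + 1) → M, IsSkein z G → (∀ β, G (BraidGroup.incl n β) ∈ S) →
      (∀ α β, G (BraidGroup.incl n α * last n hn * BraidGroup.incl n β) ∈ S) →
      ∀ α β, G (BraidGroup.incl n α * last n hn * BraidGroup.incl n β * last n hn) ∈ S)
    {G : BraidGroup (n + 1) → M} (hG : IsSkein z G) (h₀ : ∀ β, G (BraidGroup.incl n β) ∈ S)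
    (h₁ : ∀ α β, G (BraidGroup.incl n α * last n hn * BraidGroup.incl n β) ∈ S)
    (β : BraidGroup (n + 1)) : G β ∈ S := by
  have h₀' : ∀ (G : BraidGroup (n + 1) → M), (∀ β, G (BraidGroup.incl n β) ∈ S) →
      (∀ α β, G (BraidGroup.incl n α * last n hn * BraidGroup.incl n β) ∈ S) →
      ∀ i β, G (BraidGroup.incl n β * σ i) ∈ S := by
    intro G h₀ h₁ i β
    obtain ⟨j, hj⟩ | hi := σ_eq_incl_or_last hn i
    · rw [hj, ← map_mul]; exact h₀ _
    · rw [hi]; simpa using h₁ β 1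
  have h₁' : ∀ (G : BraidGroup (n + 1) → M), IsSkein z G → (∀ β, G (BraidGroup.incl n β) ∈ S) →
      (∀ α β, G (BraidGroup.incl n α * last n hn * BraidGroup.incl n β) ∈ S) →
      ∀ i α β, G (BraidGroup.incl n α * last n hn * BraidGroup.incl n β * σ i) ∈ S := by
    intro G hG h₀ h₁ i α β
    obtain ⟨j, hj⟩ | hi := σ_eq_incl_or_last hn i
    · rw [hj, mul_assoc _ _ (BraidGroup.incl n (σ j)), ← map_mul]; exact h₁ _ _
    · rw [hi]; exact key G hG h₀ h₁ α β
  have inv : ∀ (G : BraidGroup (n + 1) → M), IsSkein z G → ∀ i β, G β ∈ S → G (β * σ i) ∈ S →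
      G (β * (σ i)⁻¹) ∈ S := by
    intro G hG i β h h'
    have := hG.apply_mul_inv β 1 i
    simp only [mul_one] at this
    rw [this]
    exact S.sub_mem h' (hS _ h)
  induction β using induction_right generalizing G with
  | one => simpa using h₀ 1
  | mul β i ih => exact ih (hG.mul_right _) (h₀' G h₀ h₁ i) (h₁' G hG h₀ h₁ i)
  | mul_inv β i ih =>
    exact ih (hG.mul_right _) (fun β => inv G hG i _ (h₀ β) (h₀' G h₀ h₁ i β))
      fun α β => inv G hG i _ (h₁ α β) (h₁' G hG h₀ h₁ i α β)

/-- `T_n² = z T_n + 1`, in the middle of a word. -/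
theorem apply_last_mul_last (hn : 1 ≤ n) {G : BraidGroup (n + 1) → M} (hG : IsSkein z G)
    (α β : BraidGroup (n + 1)) :
    G (α * last n hn * last n hn * β) = z (G (α * last n hn * β)) + G (α * β) := by
  rw [last, hG, mul_inv_cancel_right]

/-- A skein function on `B_{n+1}` is controlled by its values on `B_n` and on `B_n σ_n B_n`: in
the Hecke algebra, `H_{n+1} = H_n + H_n T_n H_n`. -/
theorem mem_of_mem (S : AddSubgroup M) (hS : ∀ x ∈ S, z x ∈ S) (hn : 1 ≤ n)
    {G : BraidGroup (n + 1) → M} (hG : IsSkein z G) (h₀ : ∀ β, G (BraidGroup.incl n β) ∈ S)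
    (h₁ : ∀ α β, G (BraidGroup.incl n α * last n hn * BraidGroup.incl n β) ∈ S)
    (β : BraidGroup (n + 1)) : G β ∈ S := by
  induction n, hn using Nat.le_induction with
  | base =>
    refine mem_of_mem_of_last S hS le_rfl (fun G hG h₀ h₁ α β => ?_) hG h₀ h₁ β
    rw [Subsingleton.elim β 1, map_one, mul_one, ← mul_one (_ * _ * _),
      hG.apply_last_mul_last le_rfl, mul_one]
    exact S.add_mem (hS _ (by simpa using h₁ α 1)) (by simpa using h₀ α)
  | succ n hn IH =>
    refine mem_of_mem_of_last S hS (by omega) (fun G hG h₀ h₁ α β => ?_) hG h₀ h₁ β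
    -- Reduce the middle factor `β ∈ B_{n+1}` by the induction hypothesis.
    refine IH (hG.incl (BraidGroup.incl (n + 1) α * last (n + 1) _) (last (n + 1) _))
      (fun γ => ?_) (fun γ δ => ?_) β
    · rw [mul_assoc (BraidGroup.incl (n + 1) α), last_mul_incl_incl hn, ← mul_assoc, ← map_mul,
        ← mul_one (_ * _ * _), hG.apply_last_mul_last]
      exact S.add_mem (hS _ (by simpa using h₁ (α * BraidGroup.incl n γ) 1))
        (by simpa using h₀ (α * BraidGroup.incl n γ))
    · have e : BraidGroup.incl (n + 1) α * last (n + 1) (by omega) * BraidGroup.incl (n + 1)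
          (BraidGroup.incl n γ * last n hn * BraidGroup.incl n δ) * last (n + 1) (by omega) =
          BraidGroup.incl (n + 1) (α * BraidGroup.incl n γ * last n hn) *
            last (n + 1) (by omega) *
            BraidGroup.incl (n + 1) (last n hn * BraidGroup.incl n δ) := by
        have h₁ := last_mul_incl_incl hn γ
        have h₂ := last_mul_incl_incl hn δ
        have h₃ := last_incl_last_last hn
        simp only [map_mul]
        calc _ = BraidGroup.incl (n + 1) α *
              (last (n + 1) (by omega) * BraidGroup.incl (n + 1) (BraidGroup.incl n γ)) *
              BraidGroup.incl (n + 1) (last n hn) *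
              (BraidGroup.incl (n + 1) (BraidGroup.incl n δ) * last (n + 1) (by omega)) := by
              simp only [mul_assoc]
          _ = BraidGroup.incl (n + 1) α * BraidGroup.incl (n + 1) (BraidGroup.incl n γ) *
              (last (n + 1) (by omega) * BraidGroup.incl (n + 1) (last n hn) *
                last (n + 1) (by omega)) * BraidGroup.incl (n + 1) (BraidGroup.incl n δ) := by
              rw [h₁, ← h₂]; simp only [mul_assoc]
          _ = _ := by rw [h₃]; simp only [mul_assoc]
      rw [e]
      exact h₁ _ _

end IsSkein

/-- A Markov trace with values in an abelian group: the properties that Ocneanu's trace, suitably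
normalised, has as a function of closed braids. Adding a free strand multiplies it by `d` and a
positive stabilization multiplies it by `z`. -/
structure IsMarkovTrace (z d : M →+ M) (G : ClosedBraid → M) : Prop where
  skein : ∀ (n : ℕ) (hn : 1 ≤ n), IsSkein z fun β : BraidGroup n => G ⟨n, hn, β⟩
  conj : ∀ (n : ℕ) (hn : 1 ≤ n) (α β : BraidGroup n), G ⟨n, hn, α * β⟩ = G ⟨n, hn, β * α⟩
  incl : ∀ (n : ℕ) (hn : 1 ≤ n) (β : BraidGroup n),
    G ⟨n + 1, Nat.le_add_left 1 n, incl n β⟩ = d (G ⟨n, hn, β⟩)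
  stab : ∀ (n : ℕ) (hn : 1 ≤ n) (β : BraidGroup n),
    G ⟨n + 1, Nat.le_add_left 1 n, BraidGroup.incl n β * last n hn⟩ = z (G ⟨n, hn, β⟩)

namespace IsMarkovTrace

variable {z d : M →+ M} {G G' : ClosedBraid → M}

/-- A Markov trace takes its values wherever its value at the unknot and the operators `z` and `d`
force it to: every closed braid is reduced to the unknot by skein relations, conjugations and
removals of the last strand. -/
theorem mem (hG : IsMarkovTrace z d G) (S : ℕ → AddSubgroup M) (h1 : G ⟨1, le_rfl, 1⟩ ∈ S 1)
    (hz : ∀ n, ∀ x ∈ S n, z x ∈ S n) (hz' : ∀ n, ∀ x ∈ S n, z x ∈ S (n + 1))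
    (hd : ∀ n, ∀ x ∈ S n, d x ∈ S (n + 1)) (c : ClosedBraid) : G c ∈ S c.strands := by
  obtain ⟨n, hn, β⟩ := c
  dsimp only
  induction n, hn using Nat.le_induction with
  | base => rwa [Subsingleton.elim β 1]
  | succ n hn ih =>
    refine (hG.skein (n + 1) _).mem_of_mem (S (n + 1)) (hz (n + 1)) hn (fun β => ?_)
      (fun α β => ?_) β
    · rw [hG.incl n hn]; exact hd _ _ (ih β)
    · rw [hG.conj, ← mul_assoc, ← map_mul, hG.stab n hn]; exact hz' _ _ (ih _)

theorem sub (hG : IsMarkovTrace z d G) (hG' : IsMarkovTrace z d G') :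
    IsMarkovTrace z d (G - G') where
  skein n hn α β i := by
    have h := hG.skein n hn α β i
    have h' := hG'.skein n hn α β i
    simp only [Pi.sub_apply, map_sub] at *
    rw [h, h']; abel
  conj n hn α β := by simp only [Pi.sub_apply, hG.conj n hn α, hG'.conj n hn α]
  incl n hn β := by simp only [Pi.sub_apply, hG.incl n hn, hG'.incl n hn, map_sub]
  stab n hn β := by simp only [Pi.sub_apply, hG.stab n hn, hG'.stab n hn, map_sub]

/-- A Markov trace is determined by its value at the unknot. -/
theorem ext (hG : IsMarkovTrace z d G) (hG' : IsMarkovTrace z d G')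
    (h1 : G ⟨1, le_rfl, 1⟩ = G' ⟨1, le_rfl, 1⟩) : G = G' := by
  funext c
  have := (hG.sub hG').mem (fun _ => ⊥) (by simp [h1]) (by simp) (by simp) (by simp) c
  simpa [sub_eq_zero] using this

end IsMarkovTrace

end MarkovTrace

/-! ### The R-matrix representation of the braid groups -/

section RMatrix

variable {K : Type*} [Field K] {N : ℕ}

/-- The diagonal part of the R-matrix of type `A`, up to the summand `-1` on equal colours. -/
def crossCoeff (q : K) (a b : Fin N) : K := if a = b then q - 1 else if b < a then q - q⁻¹ else 0

theorem crossCoeff_self (q : K) (a : Fin N) : crossCoeff q a a = q - 1 := if_pos rfl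

theorem crossCoeff_of_lt (q : K) {a b : Fin N} (h : a < b) : crossCoeff q a b = 0 := by
  rw [crossCoeff, if_neg h.ne, if_neg h.not_gt]

theorem crossCoeff_of_gt (q : K) {a b : Fin N} (h : b < a) : crossCoeff q a b = q - q⁻¹ := by
  rw [crossCoeff, if_neg h.ne', if_pos h]

variable {ι : Type*} [DecidableEq ι]

/-- The R-matrix acting on the tensor factors `i` and `j` of a tensor power of `K^N`, whose
elements are the functions on the colourings `ι → Fin N` of the factors: a transposition plus a
diagonal operator. -/
def crossing (q : K) (i j : ι) : Module.End K ((ι → Fin N) → K) where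
  toFun φ f := φ (f ∘ Equiv.swap i j) + crossCoeff q (f i) (f j) * φ f
  map_add' φ ψ := by ext f; simp only [Pi.add_apply]; ring
  map_smul' a φ := by ext f; simp only [Pi.smul_apply, smul_eq_mul, RingHom.id_apply]; ring

theorem crossing_apply (q : K) (i j : ι) (φ : (ι → Fin N) → K) (f : ι → Fin N) :
    crossing q i j φ f = φ (f ∘ Equiv.swap i j) + crossCoeff q (f i) (f j) * φ f := rfl

theorem comp_swap_of_eq {α : Type*} {i j : ι} {f : ι → α} (h : f i = f j) :
    f ∘ Equiv.swap i j = f := by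
  funext k
  simp only [Function.comp_apply, Equiv.swap_apply_def]
  split_ifs with h1 h2
  · rw [h1, h]
  · rw [h2, h]
  · rfl

theorem comp_swap_comp_swap {α : Type*} (i j : ι) (f : ι → α) :
    (f ∘ Equiv.swap i j) ∘ Equiv.swap i j = f := by
  funext k; simp

theorem crossing_mul_self {q : K} (hq : q ≠ 0) {i j : ι} :
    (crossing q i j * crossing q i j : Module.End K ((ι → Fin N) → K)) =
      (q - q⁻¹) • crossing q i j + 1 := by
  refine LinearMap.ext fun φ => funext fun f => ?_
  simp only [Module.End.mul_apply, LinearMap.add_apply, LinearMap.smul_apply, Pi.add_apply,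
    Pi.smul_apply, Module.End.one_apply, crossing_apply, comp_swap_comp_swap, smul_eq_mul,
    Function.comp_apply, Equiv.swap_apply_left, Equiv.swap_apply_right]
  rcases lt_trichotomy (f i) (f j) with h | h | h
  · rw [crossCoeff_of_lt q h, crossCoeff_of_gt q h]; ring
  · rw [comp_swap_of_eq h, h, crossCoeff_self]; field_simp; ring
  · rw [crossCoeff_of_lt q h, crossCoeff_of_gt q h]; ring

theorem crossing_comm (q : K) {i j k l : ι} (hik : i ≠ k) (hil : i ≠ l) (hjk : j ≠ k)
    (hjl : j ≠ l) :
    (crossing q i j * crossing q k l : Module.End K ((ι → Fin N) → K)) =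
      crossing q k l * crossing q i j := by
  refine LinearMap.ext fun φ => funext fun f => ?_
  have h : (f ∘ Equiv.swap i j) ∘ Equiv.swap k l = (f ∘ Equiv.swap k l) ∘ Equiv.swap i j := by
    rw [Function.comp_assoc, Function.comp_assoc, ← Equiv.Perm.coe_mul, ← Equiv.Perm.coe_mul]
    congr 2
    refine Equiv.Perm.Disjoint.commute fun x => ?_
    simp only [Equiv.swap_apply_def]
    grind
  simp only [Module.End.mul_apply, crossing_apply, Function.comp_apply,
    Equiv.swap_apply_of_ne_of_ne hik hil, Equiv.swap_apply_of_ne_of_ne hjk hjl,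
    Equiv.swap_apply_of_ne_of_ne hik.symm hjk.symm, Equiv.swap_apply_of_ne_of_ne hil.symm hjl.symm,
    h]
  ring

/-- The Yang-Baxter equation. -/
theorem crossing_braid {q : K} (hq : q ≠ 0) {i j k : ι} (hij : i ≠ j) (hik : i ≠ k)
    (hjk : j ≠ k) :
    (crossing q i j * crossing q j k * crossing q i j : Module.End K ((ι → Fin N) → K)) =
      crossing q j k * crossing q i j * crossing q j k := by
  refine LinearMap.ext fun φ => funext fun f => ?_
  set s := Equiv.swap i j with hs
  set t := Equiv.swap j k with ht
  have hsts : ((f ∘ s) ∘ t) ∘ s = ((f ∘ t) ∘ s) ∘ t := by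
    funext x
    simp only [Function.comp_apply, hs, ht, Equiv.swap_apply_def]
    congr 1
    grind
  have si : s i = j := Equiv.swap_apply_left i j
  have sj : s j = i := Equiv.swap_apply_right i j
  have sk : s k = k := Equiv.swap_apply_of_ne_of_ne hik.symm hjk.symm
  have ti : t i = i := Equiv.swap_apply_of_ne_of_ne hij hik
  have tj : t j = k := Equiv.swap_apply_left j k
  have tk : t k = j := Equiv.swap_apply_right j k
  have ss : (f ∘ s) ∘ s = f := comp_swap_comp_swap i j f
  have tt : (f ∘ t) ∘ t = f := comp_swap_comp_swap j k f
  simp only [Module.End.mul_apply, crossing_apply, Function.comp_apply, ← hs, ← ht, si, sj, sk, ti,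
    tj, tk, hsts, ss, tt]
  -- Both sides are combinations of the values of `φ` at the rearrangements of `f`; these values
  -- coincide in pairs when two colours are equal.
  have e1 : f i = f j → φ (f ∘ s) = φ f ∧ φ ((f ∘ s) ∘ t) = φ (f ∘ t) ∧
      φ (((f ∘ t) ∘ s) ∘ t) = φ ((f ∘ t) ∘ s) := fun h => by
    have h' : f ∘ s = f := comp_swap_of_eq h
    rw [← hsts, h']; simp
  have e2 : f j = f k → φ (f ∘ t) = φ f ∧ φ ((f ∘ t) ∘ s) = φ (f ∘ s) ∧
      φ (((f ∘ t) ∘ s) ∘ t) = φ ((f ∘ s) ∘ t) := fun h => by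
    have h' : f ∘ t = f := comp_swap_of_eq h
    rw [h']; simp
  have e3 : f i = f k → φ ((f ∘ s) ∘ t) = φ (f ∘ s) ∧ φ ((f ∘ t) ∘ s) = φ (f ∘ t) ∧
      φ (((f ∘ t) ∘ s) ∘ t) = φ f := fun h => by
    have h₁ : (f ∘ s) ∘ t = f ∘ s := comp_swap_of_eq (by simp [sj, sk, h])
    have h₂ : (f ∘ t) ∘ s = f ∘ t := comp_swap_of_eq (by simp [ti, tj, h])
    rw [h₁, h₂, tt]; simp
  generalize φ (((f ∘ t) ∘ s) ∘ t) = x₁ at *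
  generalize φ ((f ∘ t) ∘ s) = x₂ at *
  generalize φ ((f ∘ s) ∘ t) = x₃ at *
  generalize φ (f ∘ s) = x₄ at *
  generalize φ (f ∘ t) = x₅ at *
  generalize φ f = x₆ at *
  clear hsts ss tt
  generalize f i = a at *
  generalize f j = b at *
  generalize f k = c at *
  rcases lt_trichotomy a b with h | h | h <;> rcases lt_trichotomy b c with h' | h' | h'
  · simp only [crossCoeff_of_lt, crossCoeff_of_gt, h, h', h.trans h']; ring
  · obtain ⟨rfl, rfl, rfl⟩ := e2 h'
    subst h'
    simp only [crossCoeff_self, crossCoeff_of_lt, crossCoeff_of_gt, h]; ring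
  · rcases lt_trichotomy a c with h'' | h'' | h''
    · simp only [crossCoeff_of_lt, crossCoeff_of_gt, h, h', h'']; ring
    · obtain ⟨rfl, rfl, rfl⟩ := e3 h''
      subst h''
      simp only [crossCoeff_self, crossCoeff_of_lt, crossCoeff_of_gt, h]; ring
    · simp only [crossCoeff_of_lt, crossCoeff_of_gt, h, h', h'']; ring
  · obtain ⟨rfl, rfl, rfl⟩ := e1 h
    subst h
    simp only [crossCoeff_self, crossCoeff_of_lt, crossCoeff_of_gt, h']; ring
  · obtain ⟨rfl, rfl, rfl⟩ := e1 h
    obtain ⟨rfl, rfl, -⟩ := e2 h'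
    subst h h'
    rfl
  · obtain ⟨rfl, rfl, rfl⟩ := e1 h
    subst h
    simp only [crossCoeff_self, crossCoeff_of_lt, crossCoeff_of_gt, h']; field_simp; ring
  · rcases lt_trichotomy a c with h'' | h'' | h''
    · simp only [crossCoeff_of_lt, crossCoeff_of_gt, h, h', h'']; ring
    · obtain ⟨rfl, rfl, rfl⟩ := e3 h''
      subst h''
      simp only [crossCoeff_self, crossCoeff_of_lt, crossCoeff_of_gt, h]; ring
    · simp only [crossCoeff_of_lt, crossCoeff_of_gt, h, h', h'']; ring
  · obtain ⟨rfl, rfl, rfl⟩ := e2 h'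
    subst h'
    simp only [crossCoeff_self, crossCoeff_of_lt, crossCoeff_of_gt, h]; field_simp; ring
  · simp only [crossCoeff_of_lt, crossCoeff_of_gt, h, h', h'.trans h]; ring

/-- The R-matrix as a unit: `T⁻¹ = T - z`. -/
def crossingUnit {q : K} (hq : q ≠ 0) (i j : ι) :
    (Module.End K ((ι → Fin N) → K))ˣ where
  val := crossing q i j
  inv := crossing q i j - (q - q⁻¹) • 1
  val_inv := by
    rw [mul_sub, crossing_mul_self hq, mul_smul_comm, mul_one]; abel
  inv_val := by
    rw [sub_mul, crossing_mul_self hq, smul_mul_assoc, one_mul]; abel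

/-! ### Quantum traces of braids -/

/-- The position of the left strand of the `i`-th generator. -/
def leftPos {n : ℕ} (i : Fin (n - 1)) : Fin n := ⟨i, by omega⟩

/-- The position of the right strand of the `i`-th generator. -/
def rightPos {n : ℕ} (i : Fin (n - 1)) : Fin n := ⟨i + 1, by omega⟩

/-- The R-matrix representation of `B_n` on the `n`-th tensor power of `K^N`. -/
def braidRep {q : K} (hq : q ≠ 0) (N n : ℕ) :
    BraidGroup n →* (Module.End K ((Fin n → Fin N) → K))ˣ :=
  PresentedGroup.toGroup (f := fun i => crossingUnit hq (leftPos i) (rightPos i)) (by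
    rintro r (⟨i, j, h⟩ | ⟨i, j, h⟩)
    · simp only [map_mul, map_inv, FreeGroup.lift_apply_of]
      refine commutatorElement_eq_one_iff_mul_comm.mpr (Units.ext ?_)
      apply crossing_comm <;> simp only [leftPos, rightPos, ne_eq, Fin.mk.injEq] <;> omega
    · simp only [map_mul, map_inv, FreeGroup.lift_apply_of]
      refine mul_inv_eq_one.mpr (Units.ext ?_)
      have e : leftPos j = rightPos i := by simp [leftPos, rightPos, h]
      rw [e]
      apply crossing_braid hq <;> simp only [leftPos, rightPos, ne_eq, Fin.mk.injEq] <;> omega)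

variable {q : K} (hq : q ≠ 0)

theorem braidRep_σ {n : ℕ} (i : Fin (n - 1)) :
    (braidRep hq N n (σ i) : Module.End K ((Fin n → Fin N) → K)) =
      crossing q (leftPos i) (rightPos i) := by
  simp [braidRep, σ, crossingUnit]

theorem braidRep_σ_inv {n : ℕ} (i : Fin (n - 1)) :
    ((braidRep hq N n (σ i)⁻¹ : (Module.End K ((Fin n → Fin N) → K))ˣ) :
      Module.End K ((Fin n → Fin N) → K)) =
      crossing q (leftPos i) (rightPos i) - (q - q⁻¹) • 1 := by
  rw [map_inv]; simp [braidRep, σ, crossingUnit]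

/-- The weight of a colouring, with the colour `a` having weight `q ^ (-2a)`. -/
def weight (q : K) {n : ℕ} (f : Fin n → Fin N) : K := ∏ k, (q⁻¹ ^ 2) ^ (f k : ℕ)

/-- The quantum trace of the R-matrix representation, that is the trace weighted by `weight`. -/
def braidTrace (N : ℕ) {n : ℕ} (β : BraidGroup n) : K :=
  ∑ f : Fin n → Fin N, weight q f *
    (braidRep hq N n β : Module.End K ((Fin n → Fin N) → K)) (Pi.single f 1) f

theorem braidTrace_skein {n : ℕ} (α β : BraidGroup n) (i : Fin (n - 1)) :
    braidTrace hq N (α * σ i * β) =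
      (q - q⁻¹) * braidTrace hq N (α * β) + braidTrace hq N (α * (σ i)⁻¹ * β) := by
  simp only [braidTrace, Finset.mul_sum, ← Finset.sum_add_distrib]
  refine Finset.sum_congr rfl fun f _ => ?_
  simp only [map_mul, Units.val_mul, braidRep_σ, braidRep_σ_inv, mul_sub, sub_mul,
    mul_smul_comm, smul_mul_assoc, mul_one, LinearMap.sub_apply, LinearMap.smul_apply,
    Pi.sub_apply, Pi.smul_apply, smul_eq_mul]
  ring

/-- Multiplication by the weights. -/
def weightEnd (q : K) (N n : ℕ) : Module.End K ((Fin n → Fin N) → K) where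
  toFun φ f := weight q f * φ f
  map_add' φ ψ := by ext f; simp only [Pi.add_apply]; ring
  map_smul' a φ := by ext f; simp only [Pi.smul_apply, smul_eq_mul, RingHom.id_apply]; ring

theorem weight_comp_perm {n : ℕ} (f : Fin n → Fin N) (e : Equiv.Perm (Fin n)) :
    weight q (f ∘ e) = weight q f :=
  Equiv.prod_comp e fun k => (q⁻¹ ^ 2) ^ (f k : ℕ)

theorem weightEnd_commute {n : ℕ} (β : BraidGroup n) :
    Commute (weightEnd q N n) (braidRep hq N n β) := by
  have hσ : ∀ i : Fin (n - 1), Commute (weightEnd q N n) (crossing q (leftPos i) (rightPos i)) :=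
    fun i => LinearMap.ext fun φ => funext fun f => by
      simp only [Module.End.mul_apply, crossing_apply, weightEnd, LinearMap.coe_mk, AddHom.coe_mk,
        weight_comp_perm]
      ring
  induction β using induction_right with
  | one => simp
  | mul β i ih => rw [map_mul, Units.val_mul, braidRep_σ]; exact ih.mul_right (hσ i)
  | mul_inv β i ih =>
    rw [map_mul, Units.val_mul, braidRep_σ_inv]
    exact ih.mul_right ((hσ i).sub_right ((Commute.one_right _).smul_right _))

theorem braidTrace_eq_trace {n : ℕ} (β : BraidGroup n) :
    braidTrace hq N β =
      LinearMap.trace K _ (weightEnd q N n * (braidRep hq N n β : Module.End K _)) := by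
  rw [LinearMap.trace_eq_matrix_trace K (Pi.basisFun K (Fin n → Fin N)), Matrix.trace]
  refine Finset.sum_congr rfl fun f _ => ?_
  simp [weightEnd]

theorem braidTrace_conj {n : ℕ} (α β : BraidGroup n) :
    braidTrace hq N (α * β) = braidTrace hq N (β * α) := by
  rw [braidTrace_eq_trace, braidTrace_eq_trace, (braidRep hq N n).map_mul,
    (braidRep hq N n).map_mul, Units.val_mul, Units.val_mul,
    ← mul_assoc, (weightEnd_commute hq α).eq, mul_assoc, LinearMap.trace_mul_comm, mul_assoc]

/-- `B_n ⊆ B_{n+1}` acts on the first `n` tensor factors. -/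
theorem braidRep_incl {n : ℕ} (β : BraidGroup n) (φ : (Fin (n + 1) → Fin N) → K)
    (f : Fin n → Fin N) (c : Fin N) :
    (braidRep hq N (n + 1) (incl n β) : Module.End K _) φ (Fin.snoc f c) =
      (braidRep hq N n β : Module.End K _) (fun g => φ (Fin.snoc g c)) f := by
  have hσ : ∀ (i : Fin (n - 1)) (φ : (Fin (n + 1) → Fin N) → K) (f : Fin n → Fin N),
      crossing q (leftPos (n := n + 1) ⟨i, by omega⟩) (rightPos (n := n + 1) ⟨i, by omega⟩) φ
        (Fin.snoc f c) =
      crossing q (leftPos i) (rightPos i) (fun g => φ (Fin.snoc g c)) f := by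
    intro i φ f
    have hl : leftPos (n := n + 1) ⟨i, by omega⟩ = (leftPos i).castSucc := rfl
    have hr : rightPos (n := n + 1) ⟨i, by omega⟩ = (rightPos i).castSucc := rfl
    have hs : (Fin.snoc f c : Fin (n + 1) → Fin N) ∘
        Equiv.swap (leftPos i).castSucc (rightPos i).castSucc =
        Fin.snoc (f ∘ Equiv.swap (leftPos i) (rightPos i)) c := by
      funext k
      refine Fin.lastCases ?_ (fun k => ?_) k
      · rw [Function.comp_apply, Equiv.swap_apply_of_ne_of_ne (Fin.castSucc_lt_last _).ne'
          (Fin.castSucc_lt_last _).ne', Fin.snoc_last, Fin.snoc_last]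
      · have := (Fin.castSucc_injective n).swap_apply (leftPos i) (rightPos i) k
        rw [Function.comp_apply, this, Fin.snoc_castSucc, Fin.snoc_castSucc, Function.comp_apply]
    simp only [crossing_apply, hl, hr, hs, Fin.snoc_castSucc]
  induction β using induction_right generalizing φ f with
  | one => simp
  | mul β i ih =>
    simp only [map_mul, Units.val_mul, Module.End.mul_apply, ih, incl_σ, braidRep_σ, hσ]
  | mul_inv β i ih =>
    simp only [map_mul, map_inv, Units.val_mul, Module.End.mul_apply, ih, incl_σ]
    simp only [← map_inv, braidRep_σ_inv, LinearMap.sub_apply, LinearMap.smul_apply,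
      Module.End.one_apply, Pi.sub_apply, Pi.smul_apply, hσ]
    rfl

theorem sum_snoc {n : ℕ} {A : Type*} [AddCommMonoid A] (F : (Fin (n + 1) → Fin N) → A) :
    ∑ f, F f = ∑ f : Fin n → Fin N, ∑ c, F (Fin.snoc f c) := by
  rw [Finset.sum_comm, ← Fintype.sum_prod_type']
  exact (Equiv.sum_comp (Fin.snocEquiv fun _ => Fin N) F).symm

theorem weight_snoc {n : ℕ} (f : Fin n → Fin N) (c : Fin N) :
    weight q (Fin.snoc f c : Fin (n + 1) → Fin N) = weight q f * (q⁻¹ ^ 2) ^ (c : ℕ) := by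
  simp only [weight, Fin.prod_univ_castSucc, Fin.snoc_castSucc, Fin.snoc_last]

theorem single_snoc {n : ℕ} (f g : Fin n → Fin N) (c : Fin N) :
    (Pi.single (Fin.snoc f c : Fin (n + 1) → Fin N) 1 : _ → K) (Fin.snoc g c) =
      (Pi.single f 1 : _ → K) g := by
  simp only [Pi.single_apply, Fin.snoc_inj, and_true]

theorem braidTrace_incl {n : ℕ} (β : BraidGroup n) :
    braidTrace hq N (incl n β) = (∑ c ∈ Finset.range N, (q⁻¹ ^ 2) ^ c) * braidTrace hq N β := by
  rw [braidTrace, sum_snoc, braidTrace, Finset.mul_sum]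
  refine Finset.sum_congr rfl fun f _ => ?_
  rw [← Fin.sum_univ_eq_sum_range (fun c => (q⁻¹ ^ 2) ^ c), Finset.sum_mul]
  refine Finset.sum_congr rfl fun c _ => ?_
  simp only [braidRep_incl, weight_snoc, single_snoc]
  change _ * (braidRep hq N n β : Module.End K ((Fin n → Fin N) → K)) (Pi.single f 1) f = _
  ring

/-- The partial quantum trace of the R-matrix is a multiple of the identity. -/
theorem sum_crossCoeff (hq : q ≠ 0) (a : Fin N) :
    ∑ c : Fin N, (q⁻¹ ^ 2) ^ (c : ℕ) * ((if a = c then 1 else 0) + crossCoeff q a c) = q := by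
  have h : ∀ c : Fin N, (q⁻¹ ^ 2) ^ (c : ℕ) * ((if a = c then 1 else 0) + crossCoeff q a c) =
      (if a = c then (q⁻¹ ^ 2) ^ (c : ℕ) * q else 0) +
        if (c : ℕ) < a then (q⁻¹ ^ 2) ^ (c : ℕ) * (q - q⁻¹) else 0 := by
    intro c
    rcases lt_trichotomy a c with h | h | h
    · simp [crossCoeff_of_lt q h, h.ne, h.not_gt]
    · subst h; simp [crossCoeff_self]
    · simp [crossCoeff_of_gt q h, h.ne', h]
  simp only [h, Finset.sum_add_distrib, Finset.sum_ite_eq, Finset.mem_univ, if_true]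
  have h2 : ∑ c : Fin N, (if (c : ℕ) < a then (q⁻¹ ^ 2) ^ (c : ℕ) * (q - q⁻¹) else 0) =
      (∑ c ∈ Finset.range a, (q⁻¹ ^ 2) ^ c) * (q - q⁻¹) := by
    rw [Fin.sum_univ_eq_sum_range
      (fun c => if c < (a : ℕ) then (q⁻¹ ^ 2) ^ c * (q - q⁻¹) else 0), Finset.sum_mul,
      ← Finset.sum_filter]
    refine Finset.sum_congr ?_ fun _ _ => rfl
    ext c
    have := a.2
    simp only [Finset.mem_filter, Finset.mem_range]
    omega
  have h3 := geom_sum_mul (q⁻¹ ^ 2) (a : ℕ)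
  rw [h2]
  have h4 : (q - q⁻¹) = - ((q⁻¹ ^ 2) - 1) * q := by field_simp; ring
  rw [h4]
  linear_combination (-q) * h3

theorem braidTrace_stab {n : ℕ} (hn : 1 ≤ n) (β : BraidGroup n) :
    braidTrace hq N (incl n β * last n hn) = q * braidTrace hq N β := by
  rw [braidTrace, sum_snoc, braidTrace, Finset.mul_sum]
  refine Finset.sum_congr rfl fun f _ => ?_
  obtain ⟨m, rfl⟩ : ∃ m, n = m + 1 := ⟨n - 1, by omega⟩
  -- With the last colour fixed to `c` on both sides, the R-matrix is diagonal.
  have key : ∀ c : Fin N, (fun g : Fin (m + 1) → Fin N => crossing q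
        (leftPos (n := m + 1 + 1) ⟨m + 1 - 1, by omega⟩)
        (rightPos (n := m + 1 + 1) ⟨m + 1 - 1, by omega⟩)
        (Pi.single (Fin.snoc f c : Fin (m + 1 + 1) → Fin N) (1 : K)) (Fin.snoc g c)) =
      ((if f (Fin.last m) = c then 1 else 0) + crossCoeff q (f (Fin.last m)) c) •
        Pi.single f (1 : K) := by
    intro c
    funext g
    have hl : leftPos (n := m + 1 + 1) ⟨m + 1 - 1, by omega⟩ = (Fin.last m).castSucc := rfl
    have hr : rightPos (n := m + 1 + 1) ⟨m + 1 - 1, by omega⟩ = Fin.last (m + 1) := rfl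
    rw [crossing_apply, single_snoc, hl, hr, Fin.snoc_castSucc, Fin.snoc_last]
    have hiff : (Fin.snoc g c : Fin (m + 1 + 1) → Fin N) ∘
        Equiv.swap (Fin.last m).castSucc (Fin.last (m + 1)) = Fin.snoc f c ↔
        f (Fin.last m) = c ∧ g = f := by
      constructor
      · intro h
        have h1 := congrFun h (Fin.last m).castSucc
        have h2 := congrFun h (Fin.last (m + 1))
        simp only [Function.comp_apply, Equiv.swap_apply_left, Equiv.swap_apply_right,
          Fin.snoc_last, Fin.snoc_castSucc] at h1 h2
        have h3 : g (Fin.last m) = c := h2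
        refine ⟨h1.symm, ?_⟩
        rw [comp_swap_of_eq (by rw [Fin.snoc_castSucc, Fin.snoc_last, h3])] at h
        exact (Fin.snoc_inj.mp h).1
      · rintro ⟨h, rfl⟩
        exact comp_swap_of_eq (by rw [Fin.snoc_castSucc, Fin.snoc_last, h])
    rw [Pi.single_apply, if_congr hiff rfl rfl]
    by_cases hg : g = f
    · subst hg; simp
    · simp [hg]
  have : ∀ c : Fin N, weight q (Fin.snoc f c : Fin (m + 1 + 1) → Fin N) *
      (braidRep hq N (m + 1 + 1) (incl (m + 1) β * last (m + 1) hn) :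
        Module.End K ((Fin (m + 1 + 1) → Fin N) → K))
        (Pi.single (Fin.snoc f c) 1) (Fin.snoc f c) =
      ((q⁻¹ ^ 2) ^ (c : ℕ) *
        ((if f (Fin.last m) = c then 1 else 0) + crossCoeff q (f (Fin.last m)) c)) *
      (weight q f * (braidRep hq N (m + 1) β : Module.End K ((Fin (m + 1) → Fin N) → K))
        (Pi.single f 1) f) := by
    intro c
    rw [map_mul, Units.val_mul, Module.End.mul_apply, braidRep_incl, last, braidRep_σ, key,
      map_smul, weight_snoc, Pi.smul_apply, smul_eq_mul]
    ring
  rw [Finset.sum_congr rfl fun c _ => this c, ← Finset.sum_mul, sum_crossCoeff hq]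

/-- The quantum trace normalised to take the value `1` at the unknot. The factor
`1 - q ^ (-2) = z / q` for each strand turns the partial trace `q` of the R-matrix into `z`. -/
def normTrace (N : ℕ) (c : ClosedBraid) : K :=
  (1 - q⁻¹ ^ 2) ^ c.strands / (1 - (q⁻¹ ^ 2) ^ N) * braidTrace hq N c.braid

/-- The quantum invariant of type `A_{N-1}` is the Markov trace with `z = q - q⁻¹` and
`d = 1 - q ^ (-2N)`. -/
theorem isMarkovTrace_normTrace :
    IsMarkovTrace (AddMonoidHom.mulLeft (q - q⁻¹)) (AddMonoidHom.mulLeft (1 - (q⁻¹ ^ 2) ^ N))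
      (normTrace hq N) where
  skein n hn α β i := by
    simp only [normTrace, braidTrace_skein, AddMonoidHom.coe_mulLeft]; ring
  conj n hn α β := by simp only [normTrace, braidTrace_conj hq α]
  incl n hn β := by
    simp only [normTrace, braidTrace_incl, AddMonoidHom.coe_mulLeft, ← mul_neg_geom_sum]; ring
  stab n hn β := by
    simp only [normTrace, braidTrace_stab hq hn, AddMonoidHom.coe_mulLeft]
    have h : q - q⁻¹ = (1 - q⁻¹ ^ 2) * q := by field_simp
    rw [h]; ring

theorem normTrace_unknot (hN : (q⁻¹ ^ 2) ^ N ≠ 1) : normTrace hq N ⟨1, le_rfl, 1⟩ = 1 := by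
  have h := braidTrace_incl hq (N := N) (1 : BraidGroup 0)
  rw [map_one] at h
  have h0 : braidTrace hq N (1 : BraidGroup 0) = 1 := by simp [braidTrace, weight]
  rw [normTrace, h, h0, mul_one, pow_one, div_mul_eq_mul_div, mul_neg_geom_sum, div_self]
  exact sub_ne_zero.mpr hN.symm

end RMatrix

/-! ### Ocneanu's trace by interpolation -/

section Interpolation

open Polynomial

/-- The ring homomorphism `ℤ[z][y] → ℝ` with `z ↦ q - q⁻¹` and `y ↦ q ^ (-2N)`. -/
noncomputable def quantumEval (q : ℝ) (N : ℕ) : ℤ[X][X] →+* ℝ :=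
  eval₂RingHom (eval₂RingHom (Int.castRingHom ℝ) (q - q⁻¹)) ((q⁻¹ ^ 2) ^ N)

/-- The specialisations `quantumEval q N` for all real `q > 1` and all `N ≥ 1` together. -/
noncomputable def quantumEvals : ℤ[X][X] →+* ({q : ℝ // 1 < q} × ℕ → ℝ) :=
  RingHom.pi fun i => quantumEval i.1 (i.2 + 1)

theorem quantumEvals_apply (p : ℤ[X][X]) (i : {q : ℝ // 1 < q} × ℕ) :
    quantumEvals p i = quantumEval i.1 (i.2 + 1) p := rfl

theorem inv_sq_lt_one {q : ℝ} (hq : 1 < q) : q⁻¹ ^ 2 < 1 :=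
  pow_lt_one₀ (by positivity) (inv_lt_one_of_one_lt₀ hq) two_ne_zero

/-- A polynomial in `z` and `y` is determined by its quantum specialisations. -/
theorem quantumEvals_injective : Function.Injective quantumEvals := by
  rw [injective_iff_map_eq_zero]
  intro p hp
  -- For fixed `q`, the values of `y` are infinitely many roots.
  have h₁ : ∀ q : ℝ, 1 < q → p.map (eval₂RingHom (Int.castRingHom ℝ) (q - q⁻¹)) = 0 := by
    intro q hq
    refine eq_zero_of_infinite_isRoot _ ((Set.infinite_range_of_injective
      (f := fun N : ℕ => (q⁻¹ ^ 2) ^ (N + 1)) ?_).mono ?_)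
    · exact ((pow_right_strictAnti₀ (by positivity) (inv_sq_lt_one hq)).comp_strictMono
        (strictMono_id.add_const 1)).injective
    · rintro _ ⟨N, rfl⟩
      have := congrFun hp (⟨q, hq⟩, N)
      rw [Set.mem_ofPred_eq, IsRoot, eval_map]
      exact this
  ext1 j
  -- Each coefficient vanishes at `q - q⁻¹` for `q = 2, 3, …`.
  rw [coeff_zero, ← Polynomial.map_eq_zero_iff (f := Int.castRingHom ℝ) Int.cast_injective]
  refine eq_zero_of_infinite_isRoot _ ((Set.infinite_range_of_injective
      (f := fun N : ℕ => ((N : ℝ) + 2) - ((N : ℝ) + 2)⁻¹) ?_).mono ?_)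
  · refine StrictMono.injective fun a b hab => ?_
    have hab : (a : ℝ) < b := by exact_mod_cast hab
    have : ((b : ℝ) + 2)⁻¹ ≤ ((a : ℝ) + 2)⁻¹ := by gcongr
    linarith
  · rintro _ ⟨N, rfl⟩
    have := congrArg (fun r => r.coeff j) (h₁ (N + 2) (by linarith [N.cast_nonneg (α := ℝ)]))
    simpa [IsRoot, eval_map, coeff_map] using this

/-- Ocneanu's trace in two variables, with the bound on its degree in `y`. It is obtained from the
quantum invariants of type `A` by interpolation: by `IsMarkovTrace.mem`, their values at a closed
braid are those of one polynomial. -/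
theorem exists_isMarkovTrace : ∃ G : ClosedBraid → ℤ[X][X],
    IsMarkovTrace (AddMonoidHom.mulLeft (C X)) (AddMonoidHom.mulLeft (1 - X)) G ∧
    G ⟨1, le_rfl, 1⟩ = 1 ∧ ∀ c, G c ∈ degreeLT ℤ[X] c.strands := by
  let F : ClosedBraid → ({q : ℝ // 1 < q} × ℕ → ℝ) := fun c i =>
    normTrace (zero_lt_one.trans i.1.2).ne' (i.2 + 1) c
  have hz : quantumEvals (C X) = fun i => (i.1 : ℝ) - (i.1 : ℝ)⁻¹ := by
    funext i; simp [quantumEvals_apply, quantumEval]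
  have hd : quantumEvals (1 - X) = fun i => 1 - ((i.1 : ℝ)⁻¹ ^ 2) ^ (i.2 + 1) := by
    funext i; simp [quantumEvals_apply, quantumEval]
  have hF : IsMarkovTrace (AddMonoidHom.mulLeft (quantumEvals (C X)))
      (AddMonoidHom.mulLeft (quantumEvals (1 - X))) F := by
    have h : ∀ i : {q : ℝ // 1 < q} × ℕ, _ := fun i =>
      isMarkovTrace_normTrace (N := i.2 + 1) (zero_lt_one.trans i.1.2).ne'
    rw [hz, hd]
    exact
    { skein := fun n hn α β j => funext fun i => (h i).skein n hn α β j
      conj := fun n hn α β => funext fun i => (h i).conj n hn α β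
      incl := fun n hn β => funext fun i => (h i).incl n hn β
      stab := fun n hn β => funext fun i => (h i).stab n hn β }
  have hF1 : F ⟨1, le_rfl, 1⟩ = quantumEvals 1 := by
    funext i
    rw [map_one]
    exact normTrace_unknot _ (pow_lt_one₀ (by positivity) (inv_sq_lt_one i.1.2) (by omega)).ne
  have hCX : ∀ n, ∀ p ∈ degreeLT ℤ[X] n, C X * p ∈ degreeLT ℤ[X] n := fun n p hp => by
    rw [mem_degreeLT, degree_lt_iff_coeff_zero] at hp ⊢
    intro m hm
    rw [coeff_C_mul, hp m hm, mul_zero]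
  have hmem := hF.mem
    (fun n => (degreeLT ℤ[X] n).toAddSubgroup.map quantumEvals.toAddMonoidHom)
    ⟨1, by simp [mem_degreeLT], hF1.symm⟩ ?_ ?_ ?_
  · choose G hG hGF using hmem
    have hGF' : ∀ c, quantumEvals (G c) = F c := hGF
    refine ⟨G, ?_, quantumEvals_injective (by rw [hGF', hF1]), hG⟩
    constructor
    · intro n hn α β i
      apply quantumEvals_injective
      simpa [hGF'] using hF.skein n hn α β i
    · intro n hn α β
      apply quantumEvals_injective
      simpa [hGF'] using hF.conj n hn α β
    · intro n hn β
      apply quantumEvals_injective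
      simpa [hGF'] using hF.incl n hn β
    · intro n hn β
      apply quantumEvals_injective
      simpa [hGF'] using hF.stab n hn β
  · rintro n _ ⟨p, hp, rfl⟩
    exact ⟨C X * p, hCX n p hp, by simp⟩
  · rintro n _ ⟨p, hp, rfl⟩
    exact ⟨C X * p, degreeLT_mono n.le_succ (hCX n p hp), by simp⟩
  · rintro n _ ⟨p, hp, rfl⟩
    refine ⟨(1 - X) * p, ?_, by simp⟩
    simp only [Submodule.coe_toAddSubgroup, SetLike.mem_coe, mem_degreeLT,
      degree_lt_iff_coeff_zero] at hp ⊢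
    intro m hm
    obtain ⟨m, rfl⟩ : ∃ k, m = k + 1 := ⟨m - 1, by omega⟩
    rw [sub_mul, one_mul, coeff_sub, coeff_X_mul, hp _ (by omega), hp _ (by omega), sub_zero]

end Interpolation

/-! ### Existence and uniqueness of the Homflypt polynomial -/

open Polynomial (toLaurent)

namespace LaurentVZ
open LaurentPolynomial

/-- The monomial `(vz)⁻¹`. -/
noncomputable def invVZ : LaurentVZ := T (-1) * C (T (-1))

theorem vz_mul_invVZ : v * z * invVZ = 1 := by
  have h₁ : (T 1 * T (-1) : LaurentVZ) = 1 := by rw [← T_add]; rfl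
  have h₂ : (C (T 1) * C (T (-1)) : LaurentVZ) = 1 := by
    rw [← map_mul, ← T_add]; exact map_one _
  rw [v, z, invVZ, mul_mul_mul_comm, h₁, h₂, mul_one]

theorem T_add_one (k : ℤ) : (T (k + 1) : LaurentVZ) = v * T k := by rw [v, ← T_add, add_comm]

/-- The substitution `y = v²`, from `ℤ[z][y]` to `ℤ[v, v⁻¹, z, z⁻¹]`. -/
noncomputable def ofPoly : Polynomial (Polynomial ℤ) →+* LaurentVZ :=
  Polynomial.eval₂RingHom (C.comp (toLaurent (R := ℤ))) (v ^ 2)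

@[simp] theorem ofPoly_C_X : ofPoly (Polynomial.C Polynomial.X) = z := by
  simp [ofPoly, z, Polynomial.toLaurent_X]

@[simp] theorem ofPoly_X : ofPoly Polynomial.X = v ^ 2 := by simp [ofPoly]

end LaurentVZ

open LaurentVZ LaurentPolynomial

/-- The Homflypt polynomial of a closed braid, from Ocneanu's trace. -/
noncomputable def ofTrace (G : ClosedBraid → Polynomial (Polynomial ℤ)) (c : ClosedBraid) :
    LaurentVZ :=
  T (writhe c.braid) * ofPoly (G c) * invVZ ^ (c.strands - 1)

/-- Ocneanu's trace yields the Homflypt polynomial: the factor `v ^ w / (vz) ^ (n - 1)` makes it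
invariant under both stabilizations. -/
theorem exists_isHomflypt {G : ClosedBraid → Polynomial (Polynomial ℤ)}
    (hG : IsMarkovTrace (AddMonoidHom.mulLeft (Polynomial.C Polynomial.X))
      (AddMonoidHom.mulLeft (1 - Polynomial.X)) G) (hG1 : G ⟨1, le_rfl, 1⟩ = 1) :
    ∃ P : OrientedLink → LaurentVZ, IsHomflypt P ∧
      ∀ (n : ℕ) (hn : 1 ≤ n) (β : BraidGroup n), P (closure hn β) = ofTrace G ⟨n, hn, β⟩ := by
  have hstab : ∀ (n : ℕ) (hn : 1 ≤ n) (β : BraidGroup n),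
      ofTrace G ⟨n, hn, β⟩ = ofTrace G ⟨n + 1, Nat.le_add_left 1 n, incl n β * last n hn⟩ := by
    intro n hn β
    obtain ⟨m, rfl⟩ : ∃ m, n = m + 1 := ⟨n - 1, by omega⟩
    have h := hG.stab _ hn β
    simp only [ofTrace, h, AddMonoidHom.coe_mulLeft, map_mul, ofPoly_C_X, writhe_mul, writhe_incl,
      writhe_last, T_add_one, Nat.add_sub_cancel, pow_succ]
    linear_combination (-T (writhe β) * ofPoly (G ⟨m + 1, hn, β⟩) * invVZ ^ m) * vz_mul_invVZ
  have hstab' : ∀ (n : ℕ) (hn : 1 ≤ n) (β : BraidGroup n),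
      ofTrace G ⟨n, hn, β⟩ =
        ofTrace G ⟨n + 1, Nat.le_add_left 1 n, incl n β * (last n hn)⁻¹⟩ := by
    intro n hn β
    obtain ⟨m, rfl⟩ : ∃ m, n = m + 1 := ⟨n - 1, by omega⟩
    have h := (hG.skein (m + 1 + 1) (by omega)).apply_mul_inv (incl (m + 1) β) 1 ⟨m, by omega⟩
    simp only [mul_one] at h
    have h' : G ⟨m + 1 + 1, by omega, incl (m + 1) β * (last (m + 1) hn)⁻¹⟩ =
        Polynomial.C Polynomial.X * Polynomial.X * G ⟨m + 1, hn, β⟩ := by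
      have h₁ := hG.stab _ hn β
      have h₂ := hG.incl _ hn β
      simp only [AddMonoidHom.coe_mulLeft] at h h₁ h₂
      refine h.trans ?_
      rw [h₂]
      refine (congrArg (· - _) h₁).trans ?_
      ring
    have hT : (T (writhe β) : LaurentVZ) = v * T (writhe β + -1) := by
      rw [← T_add_one]; congr 1; ring
    simp only [ofTrace, h', map_mul, ofPoly_C_X, ofPoly_X, writhe_mul, writhe_incl, writhe_inv,
      writhe_last, Nat.add_sub_cancel, pow_succ, hT]
    linear_combination
      (-v * T (writhe β + -1) * ofPoly (G ⟨m + 1, hn, β⟩) * invVZ ^ m) * vz_mul_invVZ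
  refine ⟨Quot.lift (ofTrace G) ?_, ⟨?_, ?_⟩, fun n hn β => rfl⟩
  · rintro _ _ (⟨hn, α, β⟩ | ⟨hn, β⟩ | ⟨hn, β⟩)
    · simp only [ofTrace, hG.conj _ hn α β, writhe_mul, add_comm]
    · exact hstab _ hn β
    · exact hstab' _ hn β
  · change ofTrace G _ = 1
    simp [ofTrace, hG1]
  · intro n hn α β i
    change ofTrace G _ = _ * ofTrace G _ + _ * ofTrace G _
    have h := hG.skein n hn α β i
    have e₁ : (T (writhe (α * σ i * β)) : LaurentVZ) = v * T (writhe (α * β)) := by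
      rw [← T_add_one]; simp only [writhe_mul, writhe_σ]; congr 1; ring
    have e₂ : (T (writhe (α * β)) : LaurentVZ) = v * T (writhe (α * (σ i)⁻¹ * β)) := by
      rw [← T_add_one]; simp only [writhe_mul, writhe_σ, writhe_inv]; congr 1; ring
    simp only [AddMonoidHom.coe_mulLeft] at h
    simp only [ofTrace, h, map_add, map_mul, ofPoly_C_X, e₁, e₂]
    ring

/-- A function with the Homflypt properties, normalised, is a Markov trace. -/
noncomputable def toTrace (P : OrientedLink → LaurentVZ) (c : ClosedBraid) : LaurentVZ :=
  T (-writhe c.braid) * (v * z) ^ (c.strands - 1) * P (Quot.mk _ c)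

theorem IsHomflypt.isMarkovTrace {P : OrientedLink → LaurentVZ} (hP : IsHomflypt P) :
    IsMarkovTrace (AddMonoidHom.mulLeft z) (AddMonoidHom.mulLeft (1 - v ^ 2)) (toTrace P) where
  skein n hn α β i := by
    have h := hP.skein hn α β i
    have e₁ : (T (-writhe (α * β)) : LaurentVZ) = v * T (-writhe (α * σ i * β)) := by
      rw [← T_add_one]; simp only [writhe_mul, writhe_σ]; congr 1; ring
    have e₂ : (T (-writhe (α * (σ i)⁻¹ * β)) : LaurentVZ) = v * T (-writhe (α * β)) := by
      rw [← T_add_one]; simp only [writhe_mul, writhe_σ, writhe_inv]; congr 1; ring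
    simp only [BraidGroup.closure] at h
    simp only [toTrace, AddMonoidHom.coe_mulLeft, h, e₂, e₁]
    ring
  conj n hn α β := by
    have h : (Quot.mk MarkovMove ⟨n, hn, α * β⟩ : OrientedLink) = Quot.mk _ ⟨n, hn, β * α⟩ :=
      Quot.sound (.conj hn α β)
    simp only [toTrace, h, writhe_mul, add_comm]
  incl n hn β := by
    obtain ⟨m, rfl⟩ : ∃ m, n = m + 1 := ⟨n - 1, by omega⟩
    have h₁ : (Quot.mk MarkovMove ⟨m + 1, hn, β⟩ : OrientedLink) = _ :=
      Quot.sound (.stab_pos hn β)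
    have h₂ : (Quot.mk MarkovMove ⟨m + 1, hn, β⟩ : OrientedLink) = _ :=
      Quot.sound (.stab_neg hn β)
    have h := hP.skein (n := m + 1 + 1) (by omega) (incl (m + 1) β) 1 ⟨m, by omega⟩
    simp only [mul_one, BraidGroup.closure] at h
    have h' : P (Quot.mk MarkovMove ⟨m + 1, hn, β⟩) =
        v * z * P (Quot.mk MarkovMove ⟨m + 1 + 1, by omega, incl (m + 1) β⟩) +
          v ^ 2 * P (Quot.mk MarkovMove ⟨m + 1, hn, β⟩) :=
      ((congrArg P h₁).trans h).trans (congrArg (fun x => _ + v ^ 2 * x) (congrArg P h₂.symm))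
    simp only [toTrace, AddMonoidHom.coe_mulLeft, writhe_incl, Nat.add_sub_cancel, pow_succ]
    linear_combination (-T (-writhe β) * (v * z) ^ m) * h'
  stab n hn β := by
    obtain ⟨m, rfl⟩ : ∃ m, n = m + 1 := ⟨n - 1, by omega⟩
    have h₁ : (Quot.mk MarkovMove ⟨m + 1, hn, β⟩ : OrientedLink) = _ :=
      Quot.sound (.stab_pos hn β)
    have e : (T (-writhe β) : LaurentVZ) = v * T (-(writhe β + 1)) := by
      rw [← T_add_one]; congr 1; ring
    simp only [toTrace, AddMonoidHom.coe_mulLeft, writhe_incl, writhe_mul, writhe_last,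
      Nat.add_sub_cancel, pow_succ, h₁, e]
    ring

theorem IsHomflypt.unique {P P' : OrientedLink → LaurentVZ} (hP : IsHomflypt P)
    (hP' : IsHomflypt P') : P = P' := by
  have h1 := hP.unknot
  have h1' := hP'.unknot
  simp only [BraidGroup.closure] at h1 h1'
  have h := hP.isMarkovTrace.ext hP'.isMarkovTrace (by simp only [toTrace, h1, h1'])
  funext L
  induction L using Quot.ind with
  | mk c =>
    have hc := congrFun h c
    refine (IsUnit.mul_right_inj ?_).mp hc
    exact (isUnit_T _).mul ((IsUnit.of_mul_eq_one _ vz_mul_invVZ).pow _)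

theorem existsUnique_isHomflypt : ∃! P : OrientedLink → LaurentVZ, IsHomflypt P := by
  obtain ⟨G, hG, hG1, -⟩ := exists_isMarkovTrace
  obtain ⟨P, hP, -⟩ := exists_isHomflypt hG hG1
  exact ⟨P, hP, fun P' hP' => hP'.unique hP⟩

theorem isHomflypt_homflypt : IsHomflypt homflypt :=
  Classical.epsilon_spec existsUnique_isHomflypt.exists

/-- The Homflypt polynomial in terms of Ocneanu's trace. -/
theorem homflypt_closure_mul {G : ClosedBraid → Polynomial (Polynomial ℤ)}
    (hG : IsMarkovTrace (AddMonoidHom.mulLeft (Polynomial.C Polynomial.X))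
      (AddMonoidHom.mulLeft (1 - Polynomial.X)) G) (hG1 : G ⟨1, le_rfl, 1⟩ = 1)
    {n : ℕ} (hn : 1 ≤ n) (β : BraidGroup n) :
    homflypt (closure hn β) * (v * z) ^ (n - 1) = T (writhe β) * ofPoly (G ⟨n, hn, β⟩) := by
  obtain ⟨P, hP, hPG⟩ := exists_isHomflypt hG hG1
  rw [isHomflypt_homflypt.unique hP, hPG, ofTrace, mul_assoc, ← mul_pow, mul_comm invVZ,
    vz_mul_invVZ, one_pow, mul_one]

/-! ### Conway polynomials of the elementary torus links -/

theorem atVOne_v : atVOne v = 1 := by simp [atVOne, v]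

theorem atVOne_z : atVOne z = T 1 := by simp [atVOne, z]

theorem conway_skein {n : ℕ} (hn : 1 ≤ n) (α β : BraidGroup n) (i : Fin (n - 1)) :
    conway (closure hn (α * σ i * β)) =
      T 1 * conway (closure hn (α * β)) + conway (closure hn (α * (σ i)⁻¹ * β)) := by
  simp [conway, isHomflypt_homflypt.skein hn α β i, atVOne_v, atVOne_z]

theorem torusConway_add_one (p : ℤ) :
    torusConway (p + 1) = T 1 * torusConway p + torusConway (p - 1) := by
  have h := conway_skein one_le_two ((σ (0 : Fin 1) : BraidGroup 2) ^ p) 1 (0 : Fin 1)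
  rw [mul_one, mul_one, mul_one, ← zpow_add_one, ← zpow_sub_one] at h
  exact h

theorem torusConway_one : torusConway 1 = 1 := by
  have h : closure (n := 1) le_rfl 1 = closure (n := 2) one_le_two (incl 1 1 * last 1 le_rfl) :=
    Quot.sound (.stab_pos le_rfl 1)
  have h' : (incl 1 1 * last 1 le_rfl : BraidGroup 2) = (σ (0 : Fin 1)) ^ (1 : ℤ) := by
    rw [map_one, one_mul, zpow_one]; rfl
  rw [torusConway, ← h', ← h, conway, isHomflypt_homflypt.unknot, map_one]

/-- The skein relation at `σ_1⁰` involves two diagrams of the unknot, so `z C_0 = 0`. -/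
theorem torusConway_zero : torusConway 0 = 0 := by
  have h : closure (n := 1) le_rfl 1 =
      closure (n := 2) one_le_two (incl 1 1 * (last 1 le_rfl)⁻¹) :=
    Quot.sound (.stab_neg le_rfl 1)
  have h' : (incl 1 1 * (last 1 le_rfl)⁻¹ : BraidGroup 2) = (σ (0 : Fin 1)) ^ (-1 : ℤ) := by
    rw [map_one, one_mul, zpow_neg_one]; rfl
  have h₁ : torusConway (-1) = 1 := by
    rw [torusConway, ← h', ← h, conway, isHomflypt_homflypt.unknot, map_one]
  have h₂ := torusConway_add_one 0
  rw [zero_add, zero_sub, torusConway_one, h₁] at h₂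
  refine (isUnit_T (R := ℤ) 1).mul_right_eq_zero.mp ?_
  linear_combination -h₂

theorem torusConway_three : torusConway 3 = 1 + T 2 := by
  have h₁ := torusConway_add_one 1
  have h₂ := torusConway_add_one 2
  have h : (T 2 : ℤ[T;T⁻¹]) = T 1 * T 1 := by rw [← T_add]; rfl
  norm_num at h₁ h₂
  rw [h₂, h₁, torusConway_zero, torusConway_one, h]
  ring

theorem torusConway_neg_aux (n : ℕ) : torusConway (-(2 * n)) = -torusConway (2 * n) ∧
    torusConway (-(2 * n + 1)) = torusConway (2 * n + 1) := by
  induction n with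
  | zero =>
    have h := torusConway_add_one 0
    simp only [torusConway_zero, zero_add, zero_sub] at h
    simp [torusConway_zero, h]
  | succ n ih =>
    have h₁ := torusConway_add_one (-(2 * n + 1))
    have h₂ := torusConway_add_one (2 * n + 1)
    have h₃ := torusConway_add_one (-(2 * n + 2))
    have h₄ := torusConway_add_one (2 * n + 2)
    push_cast
    ring_nf at h₁ h₂ h₃ h₄ ih ⊢
    rw [ih.1, ih.2] at h₁
    have h₅ : torusConway (-2 - (n : ℤ) * 2) = -torusConway (2 + (n : ℤ) * 2) := by
      linear_combination -h₁ + h₂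
    rw [ih.2, h₅] at h₃
    exact ⟨h₅, by linear_combination -h₃ - h₄⟩

theorem torusConway_neg_odd (k : ℤ) : torusConway (-(2 * k + 1)) = torusConway (2 * k + 1) := by
  obtain ⟨n, rfl | rfl⟩ := k.eq_nat_or_neg
  · exact (torusConway_neg_aux n).2
  · obtain rfl | ⟨m, rfl⟩ : n = 0 ∨ ∃ m, n = m + 1 := by
      cases n <;> simp
    · exact (torusConway_neg_aux 0).2
    · have h := (torusConway_neg_aux m).2
      push_cast
      rw [show -(2 * -((m : ℤ) + 1) + 1) = 2 * m + 1 by ring, ← h]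
      congr 1

/-- The Conway polynomials `C_n` are the Fibonacci polynomials. -/
theorem torusConway_succ_eq_sum_choose : ∀ n : ℕ, torusConway (n + 1) =
    ∑ p ∈ Finset.HasAntidiagonal.antidiagonal n,
      (p.1.choose p.2 : ℤ[T;T⁻¹]) * T ((p.1 : ℤ) - p.2) :=
  Nat.twoStepInduction (by simp [torusConway_one])
    (by
      have h := torusConway_add_one 1
      norm_num [torusConway_one, torusConway_zero] at h
      norm_num [h, Finset.Nat.antidiagonal_succ])
    fun n h₁ h₂ => by
      have h := torusConway_add_one (n + 2)
      rw [show (n : ℤ) + 2 - 1 = n + 1 by ring, h₁] at h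
      rw [Finset.Nat.antidiagonal_succ'] at h₂
      rw [Finset.Nat.antidiagonal_succ_succ']
      push_cast at h₂ ⊢
      rw [show (n : ℤ) + 1 + 1 = n + 2 by ring] at h₂
      rw [h, h₂]
      simp only [Finset.sum_cons, Finset.sum_map, Function.Embedding.coe_prodMap, Prod.map_fst,
        Prod.map_snd, Function.Embedding.coeFn_mk, Function.Embedding.refl_apply,
        Nat.choose_zero_succ, Nat.choose_zero_right, Nat.cast_zero, Nat.cast_one, zero_mul,
        zero_add, one_mul]
      rw [mul_add, add_assoc, Finset.mul_sum, ← Finset.sum_add_distrib, ← T_add]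
      refine congrArg₂ (· + ·) (congrArg T (by push_cast; ring))
        (Finset.sum_congr rfl fun x _ => ?_)
      have hT : (T ((x.1 : ℤ) - x.2) : ℤ[T;T⁻¹]) = T 1 * T ((x.1 : ℤ) - (x.2 + 1 : ℕ)) := by
        rw [← T_add]; congr 1; push_cast; ring
      rw [show ((x.1.succ : ℕ) : ℤ) - (x.2.succ : ℕ) = x.1 - x.2 by push_cast; ring, hT,
        Nat.succ_eq_add_one, Nat.succ_eq_add_one, Nat.choose_succ_succ]
      push_cast
      ring

theorem torusConway_odd (k : ℕ) : torusConway (2 * k + 1) =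
    1 + ∑ i ∈ Finset.range k, ((2 * k - i).choose i : ℤ[T;T⁻¹]) * T (2 * k - 2 * i) := by
  have h := torusConway_succ_eq_sum_choose (2 * k)
  push_cast at h
  rw [h, ← Finset.Nat.sum_antidiagonal_swap, Finset.Nat.sum_antidiagonal_eq_sum_range_succ_mk]
  rw [← Finset.sum_subset (Finset.range_subset_range.mpr (by omega : k + 1 ≤ (2 * k).succ)),
    Finset.sum_range_succ, add_comm]
  · congr 1
    · simp [show 2 * k - k = k by omega]
    · refine Finset.sum_congr rfl fun i hi => ?_
      rw [Finset.mem_range] at hi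
      simp only [Prod.swap_prod_mk]
      congr 2
      push_cast [show i ≤ 2 * k by omega]
      ring
  · intro i hi hi'
    rw [Finset.mem_range] at hi hi'
    simp only [Prod.swap_prod_mk]
    rw [Nat.choose_eq_zero_of_lt (by omega), Nat.cast_zero, zero_mul]

theorem T_neg_two_mul_torusConway_sub_one (j : ℕ) (hj : 1 ≤ j) :
    T (-2) * (torusConway (2 * (j : ℤ) - 1) - 1) =
      ∑ i ∈ Finset.range (j - 1),
        ((2 * j - 2 - i).choose i : ℤ[T;T⁻¹]) * T (2 * (j : ℤ) - 4 - 2 * (i : ℤ)) := by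
  obtain ⟨k, rfl⟩ : ∃ k, j = k + 1 := ⟨j - 1, by omega⟩
  have h := torusConway_odd k
  rw [show 2 * ((k + 1 : ℕ) : ℤ) - 1 = 2 * k + 1 by push_cast; ring, h, add_sub_cancel_left,
    Finset.mul_sum]
  refine Finset.sum_congr rfl fun i _ => ?_
  rw [show 2 * (k + 1) - 2 - i = 2 * k - i by omega,
    show 2 * ((k + 1 : ℕ) : ℤ) - 4 - 2 * (i : ℤ) = -2 + (2 * k - 2 * i) by push_cast; ring, T_add]
  ring

/-! ### The coefficient polynomials -/

theorem coeff_ofPoly (p : Polynomial (Polynomial ℤ)) (j : ℕ) :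
    (ofPoly p).coeff (2 * j) = toLaurent (p.coeff j) := by
  induction p using Polynomial.induction_on' with
  | add p q hp hq =>
    rw [map_add, AddMonoidAlgebra.coeff_add, Finsupp.add_apply, hp, hq,
      Polynomial.coeff_add, map_add]
  | monomial n a =>
    have h : ofPoly (Polynomial.monomial n a) =
        AddMonoidAlgebra.single (2 * n : ℤ) (toLaurent a) := by
      rw [single_eq_C_mul_T, ofPoly, Polynomial.coe_eval₂RingHom, Polynomial.eval₂_monomial, v,
        T_pow, T_pow]
      simp only [RingHom.comp_apply]
      congr 2
      push_cast
      ring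
    rw [h, AddMonoidAlgebra.coeff_single, Finsupp.single_apply, Polynomial.coeff_monomial]
    by_cases hnj : n = j <;> simp [hnj]

theorem ofPoly_injective : Function.Injective ofPoly := fun p q h => by
  ext1 j
  apply Polynomial.toLaurent_injective
  rw [← coeff_ofPoly, ← coeff_ofPoly, h]

theorem ofPoly_sum_monomial (n : ℕ) (p : ℕ → Polynomial ℤ) :
    ofPoly (∑ j ∈ Finset.range n, Polynomial.monomial j (p j)) =
      ∑ j ∈ Finset.range n, C (toLaurent (p j)) * v ^ (2 * j) := by
  rw [map_sum]
  refine Finset.sum_congr rfl fun j _ => ?_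
  rw [ofPoly, Polynomial.coe_eval₂RingHom, Polynomial.eval₂_monomial, pow_mul]
  rfl

/-- The coefficient polynomials of a closed braid are the coefficients of Ocneanu's trace. -/
theorem isCoeffs_iff {G : ClosedBraid → Polynomial (Polynomial ℤ)}
    (hG : IsMarkovTrace (AddMonoidHom.mulLeft (Polynomial.C Polynomial.X))
      (AddMonoidHom.mulLeft (1 - Polynomial.X)) G) (hG1 : G ⟨1, le_rfl, 1⟩ = 1)
    (hdeg : ∀ c, G c ∈ Polynomial.degreeLT (Polynomial ℤ) c.strands)
    {n : ℕ} (hn : 1 ≤ n) (β : BraidGroup n) (p : ℕ → Polynomial ℤ) :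
    IsCoeffs hn β p ↔ p = (G ⟨n, hn, β⟩).coeff := by
  have h0 : ∀ j, n ≤ j → (G ⟨n, hn, β⟩).coeff j = 0 := by
    have := hdeg ⟨n, hn, β⟩
    rw [Polynomial.mem_degreeLT, Polynomial.degree_lt_iff_coeff_zero] at this
    exact this
  have hsum : ∀ p : ℕ → Polynomial ℤ, (∀ j, n ≤ j → p j = 0) →
      ∀ k, (∑ j ∈ Finset.range n, Polynomial.monomial j (p j)).coeff k = p k := by
    intro p hp k
    simp only [Polynomial.finsetSum_coeff, Polynomial.coeff_monomial, Finset.sum_ite_eq',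
      Finset.mem_range]
    split_ifs with h
    · rfl
    · exact (hp k (by omega)).symm
  constructor
  · rintro ⟨hp, hform⟩
    rw [homflypt_closure_mul hG hG1, ← ofPoly_sum_monomial] at hform
    have := ofPoly_injective ((isUnit_T _).mul_right_inj.mp hform)
    funext k
    rw [this, hsum p hp]
  · rintro rfl
    refine ⟨h0, ?_⟩
    rw [homflypt_closure_mul hG hG1, ← ofPoly_sum_monomial]
    congr 2
    ext1 k
    rw [hsum _ h0]

/-- The linear functional `∑ p_j y^j ↦ ∑ p_j C_{k - 2j}`, for all `k`. -/
noncomputable def torusFunctional : Polynomial (Polynomial ℤ) →+ (ℤ → ℤ[T;T⁻¹]) where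
  toFun p k := p.sum fun j a => toLaurent a * torusConway (k - 2 * j)
  map_zero' := by funext k; simp
  map_add' p q := by
    funext k
    exact Polynomial.sum_add_index p q _ (by simp) (by simp [add_mul])

theorem torusFunctional_apply (p : Polynomial (Polynomial ℤ)) (k : ℤ) :
    torusFunctional p k = p.sum fun j a => toLaurent a * torusConway (k - 2 * j) := rfl

theorem torusFunctional_monomial (j : ℕ) (a : Polynomial ℤ) (k : ℤ) :
    torusFunctional (Polynomial.monomial j a) k = toLaurent a * torusConway (k - 2 * j) := by
  rw [torusFunctional_apply, Polynomial.sum_monomial_index _ _ (by simp)]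

theorem torusFunctional_C_X_mul (p : Polynomial (Polynomial ℤ)) (k : ℤ) :
    torusFunctional (Polynomial.C Polynomial.X * p) k = T 1 * torusFunctional p k := by
  induction p using Polynomial.induction_on' with
  | add p q hp hq => simp only [mul_add, map_add, Pi.add_apply, hp, hq]
  | monomial n a =>
    rw [Polynomial.C_mul_monomial, torusFunctional_monomial, torusFunctional_monomial, map_mul,
      Polynomial.toLaurent_X, mul_assoc]

theorem torusFunctional_X_mul (p : Polynomial (Polynomial ℤ)) (k : ℤ) :
    torusFunctional (Polynomial.X * p) k = torusFunctional p (k - 2) := by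
  induction p using Polynomial.induction_on' with
  | add p q hp hq => simp only [mul_add, map_add, Pi.add_apply, hp, hq]
  | monomial n a =>
    rw [Polynomial.X_mul_monomial, torusFunctional_monomial, torusFunctional_monomial]
    congr 2; push_cast; ring

/-- The operator `x ↦ (k ↦ x k - x (k - 2))`, by which `1 - y` acts under `torusFunctional`. -/
noncomputable def subShift : (ℤ → ℤ[T;T⁻¹]) →+ (ℤ → ℤ[T;T⁻¹]) where
  toFun x k := x k - x (k - 2)
  map_zero' := by funext k; simp
  map_add' x y := by funext k; simp only [Pi.add_apply]; ring

/-- Ocneanu's trace followed by `torusFunctional` is a Markov trace. -/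
theorem isMarkovTrace_torusFunctional {G : ClosedBraid → Polynomial (Polynomial ℤ)}
    (hG : IsMarkovTrace (AddMonoidHom.mulLeft (Polynomial.C Polynomial.X))
      (AddMonoidHom.mulLeft (1 - Polynomial.X)) G) :
    IsMarkovTrace (AddMonoidHom.mulLeft fun _ : ℤ => (T 1 : ℤ[T;T⁻¹])) subShift
      fun c => torusFunctional (G c) where
  skein n hn α β i := by
    funext k
    have h := congrArg (torusFunctional · k) (hG.skein n hn α β i)
    simpa [torusFunctional_C_X_mul] using h
  conj n hn α β := congrArg torusFunctional (hG.conj n hn α β)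
  incl n hn β := by
    funext k
    have h := congrArg (torusFunctional · k) (hG.incl n hn β)
    simpa [sub_mul, torusFunctional_X_mul, subShift] using h
  stab n hn β := by
    funext k
    have h := congrArg (torusFunctional · k) (hG.stab n hn β)
    simpa [torusFunctional_C_X_mul] using h

/-- The Markov trace `z ^ (n-1) u ^ (w-n+1)` of the one-dimensional representation `T_i ↦ u` of the
Hecke algebra, where `u² = z u + 1`. As `u ^ k = C_k u + C_{k-1}`, the `k`-th component is the
coefficient of `u` in its product with `u ^ k`. -/
theorem isMarkovTrace_writhe :
    IsMarkovTrace (AddMonoidHom.mulLeft fun _ : ℤ => (T 1 : ℤ[T;T⁻¹])) subShift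
      fun c k => T (c.strands - 1) * torusConway (k + writhe c.braid - c.strands + 1) where
  skein n hn α β i := by
    funext k
    have h := torusConway_add_one (k + (writhe α + writhe β) - n + 1)
    simp only [writhe_mul, writhe_σ, writhe_inv, AddMonoidHom.coe_mulLeft, Pi.add_apply,
      Pi.mul_apply]
    rw [show k + (writhe α + 1 + writhe β) - n + 1 = k + (writhe α + writhe β) - n + 1 + 1 by ring,
      show k + (writhe α + -1 + writhe β) - n + 1 = k + (writhe α + writhe β) - n + 1 - 1 by ring,
      h]
    ring
  conj n hn α β := by simp only [writhe_mul, add_comm]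
  incl n hn β := by
    funext k
    have h := torusConway_add_one (k + writhe β - n)
    have hT : (T ((n : ℤ) + 1 - 1) : ℤ[T;T⁻¹]) = T 1 * T ((n : ℤ) - 1) := by
      rw [← T_add]; congr 1; ring
    simp only [writhe_incl, subShift, AddMonoidHom.coe_mk, ZeroHom.coe_mk]
    push_cast
    rw [hT, h, show k + writhe β - ((n : ℤ) + 1) + 1 = k + writhe β - n by ring,
      show k - 2 + writhe β - (n : ℤ) + 1 = k + writhe β - n - 1 by ring]
    ring
  stab n hn β := by
    funext k
    have hT : (T ((n : ℤ) + 1 - 1) : ℤ[T;T⁻¹]) = T 1 * T ((n : ℤ) - 1) := by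
      rw [← T_add]; congr 1; ring
    simp only [writhe_incl, writhe_mul, writhe_last, AddMonoidHom.coe_mulLeft, Pi.mul_apply]
    push_cast
    rw [hT, show k + (writhe β + 1) - ((n : ℤ) + 1) + 1 = k + writhe β - n + 1 by ring]
    ring

/-- The relation between the coefficient polynomials that comes from `P(v, v⁻¹ - v) = 1`: it says
that Ocneanu's trace at `y = u ^ (-2)`, where `u² = z u + 1`, is the Markov trace of the
one-dimensional representation. -/
theorem IsCoeffs.sum_mul_torusConway {n : ℕ} {hn : 1 ≤ n} {β : BraidGroup n}
    {p : ℕ → Polynomial ℤ} (hp : IsCoeffs hn β p) (k : ℤ) :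
    ∑ j ∈ Finset.range n, toLaurent (p j) * torusConway (k - 2 * j) =
      T ((n : ℤ) - 1) * torusConway (k + writhe β - n + 1) := by
  obtain ⟨G, hG, hG1, hdeg⟩ := exists_isMarkovTrace
  have h := (isMarkovTrace_torusFunctional hG).ext isMarkovTrace_writhe (by
    funext k
    have := torusFunctional_monomial 0 1 k
    simp only [Polynomial.monomial_zero_left, map_one, one_mul] at this
    simp [hG1, this])
  have h' := congrFun (congrFun h ⟨n, hn, β⟩) k
  dsimp only at h'
  rw [← h', torusFunctional_apply, (isCoeffs_iff hG hG1 hdeg hn β p).mp hp]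
  have hc := (Polynomial.degree_lt_iff_coeff_zero _ _).mp
    (Polynomial.mem_degreeLT.mp (hdeg ⟨n, hn, β⟩))
  refine (Polynomial.sum_eq_of_subset (fun j a => toLaurent a * torusConway (k - 2 * j))
    (fun j => by rw [map_zero, zero_mul]) fun j hj => ?_).symm
  by_contra hj'
  exact Polynomial.mem_support_iff.mp hj (hc j (by simpa using hj'))

/-- The relation between the coefficient polynomials that comes from `P(1, z) = ∇(z)`. -/
theorem IsCoeffs.sum_eq {n : ℕ} {hn : 1 ≤ n} {β : BraidGroup n}
    {p : ℕ → Polynomial ℤ} (hp : IsCoeffs hn β p) :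
    ∑ j ∈ Finset.range n, toLaurent (p j) = T ((n : ℤ) - 1) * conway (closure hn β) := by
  have h := congrArg atVOne hp.form
  have hT : atVOne (T (writhe β)) = 1 := by simp [atVOne]
  have hC : ∀ a, atVOne (C a) = a := fun a => by simp [atVOne]
  simp only [map_mul, map_pow, map_sum, atVOne_v, atVOne_z, hT, hC, one_pow, one_mul, mul_one,
    T_pow] at h
  rw [← h, mul_comm, conway]
  congr 2
  push_cast [hn]
  ring

/-- Since `p_j = 0` for `j ≥ n`, the first three terms can be split off whatever `n` is. -/
theorem IsCoeffs.sum_range {n : ℕ} {hn : 1 ≤ n} {β : BraidGroup n}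
    {p : ℕ → Polynomial ℤ} (hp : IsCoeffs hn β p) (f : ℕ → ℤ[T;T⁻¹]) :
    ∑ j ∈ Finset.range n, toLaurent (p j) * f j =
      toLaurent (p 0) * f 0 + toLaurent (p 1) * f 1 + toLaurent (p 2) * f 2 +
        ∑ j ∈ Finset.Ico 3 n, toLaurent (p j) * f j := by
  have h : ∑ j ∈ Finset.range n, toLaurent (p j) * f j =
      ∑ j ∈ Finset.range (max n 3), toLaurent (p j) * f j :=
    Finset.sum_subset (Finset.range_subset_range.mpr (le_max_left _ _)) fun j _ hj => by
      rw [hp.eq_zero j (by simpa using hj), map_zero, zero_mul]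
  have h' : Finset.Ico 3 n = Finset.Ico 3 (max n 3) := by
    ext j; simp only [Finset.mem_Ico]; omega
  rw [h, h', ← Finset.sum_range_add_sum_Ico _ (le_max_right n 3)]
  simp [Finset.sum_range_succ]

/-- The difference of the relations `sum_mul_torusConway` and `sum_eq`, divided by `z²`. For
`k = 1` and `k = 3` all but one of the three coefficients `C_k - 1`, `C_{k-2} - 1`, `C_{k-4} - 1`
vanish, and the remaining one is `z²`. -/
theorem IsCoeffs.sum_mul_torusConway_sub_one {n : ℕ} {hn : 1 ≤ n} {β : BraidGroup n}
    {p : ℕ → Polynomial ℤ} (hp : IsCoeffs hn β p) (k : ℤ) :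
    T (-2) * (toLaurent (p 0) * (torusConway k - 1) + toLaurent (p 1) * (torusConway (k - 2) - 1) +
      toLaurent (p 2) * (torusConway (k - 4) - 1)) +
      ∑ j ∈ Finset.Ico 3 n, T (-2) * (torusConway (k - 2 * j) - 1) * toLaurent (p j) =
    T ((n : ℤ) - 3) * (torusConway (writhe β + (k + 1) - n) - conway (closure hn β)) := by
  have h : ∑ j ∈ Finset.range n, toLaurent (p j) * (torusConway (k - 2 * j) - 1) =
      T ((n : ℤ) - 1) * (torusConway (writhe β + (k + 1) - n) - conway (closure hn β)) := by
    simp only [mul_sub, mul_one, Finset.sum_sub_distrib, hp.sum_mul_torusConway, hp.sum_eq]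
    congr 3; ring
  rw [hp.sum_range] at h
  rw [show (n : ℤ) - 3 = -2 + (n - 1) by ring, T_add, mul_assoc, ← h,
    mul_add (T (-2)) _ (Finset.sum _ _), Finset.mul_sum]
  rw [show k - 2 * ((0 : ℕ) : ℤ) = k by simp, show k - 2 * ((1 : ℕ) : ℤ) = k - 2 by simp,
    show k - 2 * ((2 : ℕ) : ℤ) = k - 4 by simp]
  refine congrArg (_ + ·) (Finset.sum_congr rfl fun j _ => ?_)
  ring

open LaurentPolynomial in
theorem mainTheorem2 :
    (∃! P : OrientedLink → LaurentVZ, IsHomflypt P) ∧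
    (∀ (n : ℕ) (hn : 1 ≤ n) (β : BraidGroup n),
      (∃! p : ℕ → Polynomial ℤ, IsCoeffs hn β p) ∧
      ∀ p : ℕ → Polynomial ℤ, IsCoeffs hn β p →
        (Polynomial.toLaurent (p 0) =
          T ((n : ℤ) - 3) *
              (torusConway (BraidGroup.writhe β + 4 - n) - conway (BraidGroup.closure hn β)) -
            ∑ j ∈ Finset.Ico 3 n,
              T (-2) * (torusConway (2 * (j : ℤ) - 3) - 1) * Polynomial.toLaurent (p j)) ∧
        (Polynomial.toLaurent (p 1) =
          T ((n : ℤ) - 1) * conway (BraidGroup.closure hn β) -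
            Polynomial.toLaurent (p 0) - Polynomial.toLaurent (p 2) -
            ∑ j ∈ Finset.Ico 3 n, Polynomial.toLaurent (p j)) ∧
        (Polynomial.toLaurent (p 2) =
          T ((n : ℤ) - 3) *
              (torusConway (BraidGroup.writhe β + 2 - n) - conway (BraidGroup.closure hn β)) -
            ∑ j ∈ Finset.Ico 3 n,
              T (-2) * (torusConway (2 * (j : ℤ) - 1) - 1) * Polynomial.toLaurent (p j))) ∧
    (∀ j : ℕ, 3 ≤ j →
      T (-2) * (torusConway (2 * (j : ℤ) - 3) - 1) =
        ∑ i ∈ Finset.range (j - 2),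
          ((2 * j - 4 - i).choose i : ℤ[T;T⁻¹]) * T (2 * (j : ℤ) - 6 - 2 * (i : ℤ))) ∧
    (∀ j : ℕ, 1 ≤ j →
      T (-2) * (torusConway (2 * (j : ℤ) - 1) - 1) =
        ∑ i ∈ Finset.range (j - 1),
          ((2 * j - 2 - i).choose i : ℤ[T;T⁻¹]) * T (2 * (j : ℤ) - 4 - 2 * (i : ℤ))) := by
  have hneg : torusConway (-1) = 1 := by
    simpa [torusConway_one] using torusConway_neg_odd 0
  have hneg' : torusConway (-3) = 1 + T 2 := by
    simpa [torusConway_three] using torusConway_neg_odd 1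
  refine ⟨existsUnique_isHomflypt, fun n hn β => ⟨?_, fun p hp => ⟨?_, ?_, ?_⟩⟩, fun j hj => ?_,
    T_neg_two_mul_torusConway_sub_one⟩
  · obtain ⟨G, hG, hG1, hdeg⟩ := exists_isMarkovTrace
    simp only [isCoeffs_iff hG hG1 hdeg, existsUnique_eq]
  · have h := hp.sum_mul_torusConway_sub_one 3
    have e : ∀ j : ℕ, torusConway (2 * j - 3) = torusConway (3 - 2 * j) := fun j => by
      rw [show (2 * j - 3 : ℤ) = 2 * (j - 2) + 1 by ring, ← torusConway_neg_odd]; congr 1; ring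
    simp only [e]
    generalize ∑ j ∈ Finset.Ico 3 n, T (-2) * (torusConway (3 - 2 * j) - 1) * toLaurent (p j) = S
      at h ⊢
    norm_num [torusConway_three, torusConway_one, hneg] at h
    linear_combination h
  · have h := hp.sum_range fun _ => 1
    simp only [mul_one, hp.sum_eq] at h
    linear_combination -h
  · have h := hp.sum_mul_torusConway_sub_one 1
    have e : ∀ j : ℕ, torusConway (2 * j - 1) = torusConway (1 - 2 * j) := fun j => by
      rw [show (2 * j - 1 : ℤ) = 2 * (j - 1) + 1 by ring, ← torusConway_neg_odd]; congr 1; ring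
    simp only [e]
    generalize ∑ j ∈ Finset.Ico 3 n, T (-2) * (torusConway (1 - 2 * j) - 1) * toLaurent (p j) = S
      at h ⊢
    norm_num [torusConway_one, hneg, hneg'] at h
    linear_combination h
  · obtain ⟨k, rfl⟩ : ∃ k, j = k + 1 := ⟨j - 1, by omega⟩
    have h := T_neg_two_mul_torusConway_sub_one k (by omega)
    rw [show 2 * ((k + 1 : ℕ) : ℤ) - 3 = 2 * k - 1 by push_cast; ring, h]
    refine Finset.sum_congr (by congr 1) fun i _ => ?_
    rw [show 2 * (k + 1) - 4 - i = 2 * k - 2 - i by omega,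
      show 2 * ((k + 1 : ℕ) : ℤ) - 6 - 2 * (i : ℤ) = 2 * k - 4 - 2 * i by push_cast; ring]
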